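/- Let $(I,(a_{ij}))$ be a Cartan datum: $I$ is a finite set and $(a_{ij})_{i,j\in I}$ is an integer matrix with $a_{ii}=2$, $a_{ij}\le 0$ for $i\ne j$, and $a_{ij}<0$ if and only if $a_{ji}<0$. For $i\neq j$ let $m_{ij}=2,3,4,6,\infty$ according as $a_{ij}a_{ji}=0,1,2,3,\ge 4$, and let $W$ be the Coxeter group with generators $s_i$ $(i\in I)$ and Coxeter matrix $(m_{ij})$. Let $\mathbb A_0$ be the nilCoxeter algebra: the associative $\mathbb Z$-algebra with generators $A_i$ $(i\in I)$ and relations $A_i^2=0$ and $A_iA_jA_i\cdots=A_jA_iA_j\cdots$ ($m_{ij}$ factors on each side, for $i\ne j$ with $m_{ij}<\infty$). For a word $z=z_1\cdots z_\ell$ in $I$ write $A_z=A_{z_1}\cdots A_{z_\ell}$, and for $w\in W$ let $A_w=A_z$ for any reduced word $z$ of $w$. Let $P$ be a free $\mathbb Z$-module of finite rank with elements $\alpha_i\in P$ and $\alpha_i^\vee\in\mathrm{Hom}(P,\mathbb Z)$ $(i\in I)$ such that $\langle\alpha_i^\vee,\alpha_j\rangle=a_{ij}$ (no linear independence is required; for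 an untwisted affine Cartan datum one may take the weight lattice of the underlying finite-dimensional Lie algebra with the level zero action). Put $s_i\lambda=\lambda-\langle\alpha_i^\vee,\lambda\rangle\alpha_i$ for $\lambda\in P$ and $S=\mathrm{Sym}(P)$. Let $\mathbb A$ be the nilHecke algebra: the associative $\mathbb Z$-algebra generated by $S$ and $\mathbb A_0$ with the relations $$A_i\lambda=(s_i\lambda)A_i+\langle\alpha_i^\vee,\lambda\rangle\,1\qquad(i\in I,\ \lambda\in P).$$ It is a free left $S$-module with basis $\{A_w\mid w\in W\}$. Let $\mathbb A\otimes_S\mathbb A$ be the tensor product of left $S$-modules; it is a left $\mathbb A$-module via $s\cdot(m\otimes n)=sm\otimes n$ for $s\in S$ and $$A_i\cdot(m\otimes n)=A_im\otimes n+m\otimes A_in-\alpha_iA_im\otimes A_in .$$ Let $\Delta:\mathbb A\to\mathbb A\otimes_S\mathbb A$ be $\Delta(a)=a\cdot(1\otimes 1)$. Let $\phi_0:S\to\mathbb Z$ be evaluation at $0$, and define $\phi_0^{(2)}:\mathbb A\otimes_S\mathbb A\to\mathbb A_0\otimes_{\mathbb Z}\mathbb A_0$ by $$\phi_0^{(2)}\Big(\sum_{x,y\in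 W}a_{x,y}\,A_x\otimes A_y\Big)=\sum_{x,y\in W}\phi_0(a_{x,y})\,A_x\otimes A_y\qquad(a_{x,y}\in S).$$ Let $v$ be a word in $I$. All subwords of $v$ are taken with a fixed embedding, that is, they are sets of positions of $v$, and letters of subwords are identified with positions of $v$. Let $\mathcal S_v$ be the set of tuples $\mathbf v=[v^{(1)},\dots,v^{(k)}]$, $k\ge 0$, of subwords of $v$ of length at least two, with $x_i$ (resp. $y_i$) denoting the first (resp. last) letter of $v^{(i)}$, such that 1. $v^{(i)}$ is a subword of $v\setminus\{x_1,\dots,x_{i-1}\}$ for all $i$; 2. $y_1y_2\cdots y_k$ is a subword of $v$, i.e. the positions of $y_1,\dots,y_k$ are strictly increasing; 3. $x_i\ne y_j$ (as positions of $v$) for all $i,j$. For a word $u=u_1\cdots u_\ell$ put $b_u=\prod_{i=1}^{\ell-1}b_{u_iu_{i+1}}$ with $b_{ij}=-a_{ij}$, and put $b_{\mathbf v}=\prod_{i=1}^k b_{v^{(i)}}$. For $\mathbf v\in\mathcal S_v$ let $x=\{x_1,\dots,x_k\}$ and $y=\{y_1,\dots,y_k\}$. For a subword $u$ of $v\setminus(x\cup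 y)$ let $u^\perp$ be its complement in $v\setminus(x\cup y)$, and let $u.y$ and $u^\perp.y$ be the words obtained from $u$ and $u^\perp$ by adding the letters in $y$ in the order of $v$. Then for every $w\in W$ and every reduced word $v$ of $w$, $$\phi_0^{(2)}(\Delta(A_w))=\sum_{\mathbf v\in\mathcal S_v}b_{\mathbf v}\sum_{u\subset v\setminus(x\cup y)}A_{u.y}\otimes A_{u^\perp.y}.$$ -/

import Mathlib

noncomputable section

namespace AffineNilHecke

open scoped TensorProduct

/-! ### Cartan data and Weyl groups -/

/-- A Cartan datum on the set of Dynkin nodes `I`: a generalized Cartan matrix. -/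
structure CartanDatum (I : Type*) where
  /-- the entries `a i j` of the Cartan matrix -/
  a : I → I → ℤ
  diag : ∀ i, a i i = 2
  nonpos : ∀ i j, i ≠ j → a i j ≤ 0
  neg_iff : ∀ i j, i ≠ j → (a i j < 0 ↔ a j i < 0)

/-- The order of `s_i s_j`, for `i ≠ j`, in terms of the product `a_ij a_ji`; `0` stands for `∞`. -/
def braidOrder (p : ℤ) : ℕ :=
  if p = 0 then 2 else if p = 1 then 3 else if p = 2 then 4 else if p = 3 then 6 else 0

variable {I : Type*}

open Classical in
/-- The Coxeter matrix `(m_ij)` of a Cartan datum (with Mathlib's convention `0 = ∞`). -/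
def CartanDatum.coxeterMatrix (C : CartanDatum I) : CoxeterMatrix I where
  M := Matrix.of fun i j => if i = j then 1 else braidOrder (C.a i j * C.a j i)
  isSymm := by
    ext i j
    simp only [Matrix.transpose_apply, Matrix.of_apply]
    rw [mul_comm (C.a j i), eq_comm (a := j)]
  diagonal := by intro i; simp
  off_diagonal := by
    intro i j h
    simp only [Matrix.of_apply, h, if_false, braidOrder]
    split_ifs <;> decide

/-- The Weyl group of a Cartan datum. -/
abbrev CartanDatum.Weyl (C : CartanDatum I) : Type _ := C.coxeterMatrix.Group

/-- The Weyl group with its simple reflections, as a Coxeter system. -/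
abbrev CartanDatum.cs (C : CartanDatum I) : CoxeterSystem C.coxeterMatrix C.Weyl :=
  C.coxeterMatrix.toCoxeterSystem

/-- `v ∈ R(w)`: the word `v` in the nodes is a reduced word for `w`. -/
def CartanDatum.IsReducedWord (C : CartanDatum I) (w : C.Weyl) (v : List I) : Prop :=
  C.cs.IsReduced v ∧ C.cs.wordProd v = w

theorem CartanDatum.exists_isReducedWord (C : CartanDatum I) (w : C.Weyl) :
    ∃ v, C.IsReducedWord w v := by
  obtain ⟨v, hv, h⟩ := C.cs.exists_isReduced w
  exact ⟨v, hv, h.symm⟩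

/-- A reduced word for `w`. -/
def CartanDatum.redWord (C : CartanDatum I) (w : C.Weyl) : List I :=
  (C.exists_isReducedWord w).choose

/-! ### The nilCoxeter algebra -/

/-- The product of the letters `x i` along a word in the nodes. -/
def wordProduct {R : Type*} [Monoid R] (x : I → R) (v : List I) : R := (v.map x).prod

/-- The defining relations of the nilCoxeter algebra. -/
inductive NilCoxeterRel (C : CartanDatum I) : FreeAlgebra ℤ I → FreeAlgebra ℤ I → Prop
  | sq (i : I) : NilCoxeterRel C (FreeAlgebra.ι ℤ i * FreeAlgebra.ι ℤ i) 0
  | braid (i j : I) (hij : i ≠ j) (hm : C.coxeterMatrix i j ≠ 0) :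
      NilCoxeterRel C
        (wordProduct (FreeAlgebra.ι ℤ) (CoxeterSystem.alternatingWord i j (C.coxeterMatrix i j)))
        (wordProduct (FreeAlgebra.ι ℤ) (CoxeterSystem.alternatingWord j i (C.coxeterMatrix i j)))

/-- The nilCoxeter algebra `𝔸₀` over `ℤ`. -/
def NilCoxeter (C : CartanDatum I) : Type _ := RingQuot (NilCoxeterRel C)

instance (C : CartanDatum I) : Ring (NilCoxeter C) := inferInstanceAs (Ring (RingQuot _))

/-- The generator `A_i` of the nilCoxeter algebra. -/
def NilCoxeter.gen (C : CartanDatum I) (i : I) : NilCoxeter C :=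
  RingQuot.mkRingHom (NilCoxeterRel C) (FreeAlgebra.ι ℤ i)

/-- For a word `z = z₁ ⋯ z_ℓ`, the product `A_z = A_{z₁} ⋯ A_{z_ℓ}` in the nilCoxeter algebra
(it vanishes when `z` is not reduced). -/
def NilCoxeter.word (C : CartanDatum I) (z : List I) : NilCoxeter C :=
  wordProduct (NilCoxeter.gen C) z

/-- The element `A_w` of the nilCoxeter algebra, `w ∈ W`. -/
def NilCoxeter.elt (C : CartanDatum I) (w : C.Weyl) : NilCoxeter C :=
  NilCoxeter.word C (C.redWord w)

/-! ### Realizations and the nilHecke algebra -/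

/-- Simple roots `α_j` in a weight lattice `P` and simple coroots `α_i^∨` in its dual, with
`⟨α_i^∨, α_j⟩ = a_ij`. Neither family has to be linearly independent, so that level zero weight
lattices of affine type are covered as well as the larger ones of Kac-Moody theory. -/
structure Realization (C : CartanDatum I) (P : Type*) [AddCommGroup P] where
  root : I → P
  coroot : I → P →ₗ[ℤ] ℤ
  pairing : ∀ i j, coroot i (root j) = C.a i j

/-- The level zero weight lattice of a Cartan datum modulo imaginary roots: the integral
combinations `∑ f_i Λ_i` of the fundamental weights which are killed by all central elements
`∑ c_i α_i^∨`. In affine type the only central elements are the multiples of the canonical one,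
the lattice is the weight lattice of the underlying finite-dimensional Lie algebra `𝔤` when the
type is untwisted, and `α_0` becomes `-θ`. In finite type it is the weight lattice. -/
def levelZeroLattice (C : CartanDatum I) [Fintype I] : Submodule ℤ (I → ℤ) where
  carrier := {f | ∀ c : I → ℤ, (∀ j, ∑ i, c i * C.a i j = 0) → ∑ i, c i * f i = 0}
  add_mem' hf hg c hc := by
    simp only [Pi.add_apply, mul_add, Finset.sum_add_distrib, hf c hc, hg c hc, add_zero]
  zero_mem' c _ := by simp
  smul_mem' r f hf c hc := by
    have h : ∀ i, c i * (r • f) i = r * (c i * f i) := fun i => by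
      simp only [Pi.smul_apply, smul_eq_mul]; ring
    simp only [h, ← Finset.mul_sum, hf c hc, mul_zero]

/-- The level zero realization: the lattice used in Peterson's affine nilHecke algebra. -/
def Realization.levelZero (C : CartanDatum I) [Fintype I] :
    Realization C (levelZeroLattice C) where
  root j := ⟨fun i => C.a i j, fun _ hc => hc j⟩
  coroot i := LinearMap.proj i ∘ₗ (levelZeroLattice C).subtype
  pairing _ _ := rfl

variable {C : CartanDatum I} {P : Type*} [AddCommGroup P]

/-- The simple reflection `s_i λ = λ - ⟨α_i^∨, λ⟩ α_i` on the weight lattice. -/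
def Realization.reflect (D : Realization C P) (i : I) (l : P) : P :=
  l - D.coroot i l • D.root i

/-- The defining relations of the nilHecke algebra. It is generated by `S = Sym(P)` and the `A_i`:
the first three relations make `S` a ring of coefficients, the next two are those of the
nilCoxeter algebra, the last is `A_i λ = (s_i λ) A_i + ⟨α_i^∨, λ⟩ 1`. -/
inductive NilHeckeRel (D : Realization C P) :
    FreeAlgebra ℤ (SymmetricAlgebra ℤ P ⊕ I) → FreeAlgebra ℤ (SymmetricAlgebra ℤ P ⊕ I) → Prop
  | one : NilHeckeRel D (FreeAlgebra.ι ℤ (Sum.inl 1)) 1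
  | add (s t : SymmetricAlgebra ℤ P) : NilHeckeRel D (FreeAlgebra.ι ℤ (Sum.inl (s + t)))
      (FreeAlgebra.ι ℤ (Sum.inl s) + FreeAlgebra.ι ℤ (Sum.inl t))
  | mul (s t : SymmetricAlgebra ℤ P) : NilHeckeRel D (FreeAlgebra.ι ℤ (Sum.inl (s * t)))
      (FreeAlgebra.ι ℤ (Sum.inl s) * FreeAlgebra.ι ℤ (Sum.inl t))
  | sq (i : I) : NilHeckeRel D (FreeAlgebra.ι ℤ (Sum.inr i) * FreeAlgebra.ι ℤ (Sum.inr i)) 0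
  | braid (i j : I) (hij : i ≠ j) (hm : C.coxeterMatrix i j ≠ 0) :
      NilHeckeRel D
        (wordProduct (fun k => FreeAlgebra.ι ℤ (Sum.inr k))
          (CoxeterSystem.alternatingWord i j (C.coxeterMatrix i j)))
        (wordProduct (fun k => FreeAlgebra.ι ℤ (Sum.inr k))
          (CoxeterSystem.alternatingWord j i (C.coxeterMatrix i j)))
  | comm (i : I) (l : P) :
      NilHeckeRel D
        (FreeAlgebra.ι ℤ (Sum.inr i) * FreeAlgebra.ι ℤ (Sum.inl (SymmetricAlgebra.ι ℤ P l)))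
        (FreeAlgebra.ι ℤ (Sum.inl (SymmetricAlgebra.ι ℤ P (D.reflect i l))) *
          FreeAlgebra.ι ℤ (Sum.inr i) + algebraMap ℤ _ (D.coroot i l))

/-- The nilHecke algebra `𝔸`. -/
def NilHecke (D : Realization C P) : Type _ := RingQuot (NilHeckeRel D)

instance (D : Realization C P) : Ring (NilHecke D) := inferInstanceAs (Ring (RingQuot _))

namespace NilHecke

variable (D : Realization C P)

/-- The quotient map from the free algebra on the generators to the nilHecke algebra. -/
def mk : FreeAlgebra ℤ (SymmetricAlgebra ℤ P ⊕ I) →+* NilHecke D :=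
  RingQuot.mkRingHom (NilHeckeRel D)

theorem mk_surjective : Function.Surjective (mk D) := RingQuot.mkRingHom_surjective _

theorem mk_rel {x y : FreeAlgebra ℤ (SymmetricAlgebra ℤ P ⊕ I)} (h : NilHeckeRel D x y) :
    mk D x = mk D y := RingQuot.mkRingHom_rel h

/-- The generator `A_i` of the nilHecke algebra. -/
def gen (i : I) : NilHecke D := mk D (FreeAlgebra.ι ℤ (Sum.inr i))

/-- The ring homomorphism `S → 𝔸`. -/
def scalar : SymmetricAlgebra ℤ P →+* NilHecke D where
  toFun s := mk D (FreeAlgebra.ι ℤ (Sum.inl s))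
  map_one' := (mk_rel D .one).trans (map_one _)
  map_mul' s t := (mk_rel D (.mul s t)).trans (map_mul _ _ _)
  map_add' s t := (mk_rel D (.add s t)).trans (map_add _ _ _)
  map_zero' := by
    have h := (mk_rel D (.add 0 0)).trans (map_add _ _ _)
    rw [add_zero] at h
    exact left_eq_add.mp h

/-- `𝔸` is a left `S`-module by left multiplication. -/
instance : Module (SymmetricAlgebra ℤ P) (NilHecke D) := Module.compHom _ (scalar D)

theorem smul_def (s : SymmetricAlgebra ℤ P) (a : NilHecke D) : s • a = scalar D s * a := rfl

/-- The element `A_w` of the nilHecke algebra, `w ∈ W`. -/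
def elt (w : C.Weyl) : NilHecke D := wordProduct (gen D) (C.redWord w)

theorem gen_mul_scalar (i : I) (l : P) :
    gen D i * scalar D (SymmetricAlgebra.ι ℤ P l) =
      scalar D (SymmetricAlgebra.ι ℤ P (D.reflect i l)) * gen D i + (D.coroot i l : ℤ) := by
  have h := mk_rel D (.comm i l)
  rw [map_mul, map_add, map_mul] at h
  refine h.trans ?_
  congr 1
  simp

end NilHecke

/-! ### The tensor square and the coproduct -/

/-- `𝔸 ⊗_S 𝔸`, both factors being left `S`-modules. -/
abbrev TensorSquare (D : Realization C P) : Type _ :=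
  NilHecke D ⊗[SymmetricAlgebra ℤ P] NilHecke D

namespace NilHecke

variable (D : Realization C P)

/-- The simple root `α_i` as an element of `S`. -/
def rootS (i : I) : SymmetricAlgebra ℤ P := SymmetricAlgebra.ι ℤ P (D.root i)

/-- The biadditive map `(m, n) ↦ A_i m ⊗ n + m ⊗ A_i n - α_i A_i m ⊗ A_i n`. -/
def genActPre (i : I) : NilHecke D →+ NilHecke D →+ TensorSquare D :=
  AddMonoidHom.mk' (fun m => AddMonoidHom.mk' (fun n =>
      (gen D i * m) ⊗ₜ n + m ⊗ₜ (gen D i * n) - (rootS D i • (gen D i * m)) ⊗ₜ (gen D i * n))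
      (fun n n' => by
        simp only [mul_add, TensorProduct.tmul_add]; abel))
    (fun m m' => by
      ext n
      simp only [mul_add, TensorProduct.add_tmul, smul_add, AddMonoidHom.mk'_apply,
        AddMonoidHom.add_apply]
      abel)

theorem genActPre_apply (i : I) (m n : NilHecke D) : genActPre D i m n =
    (gen D i * m) ⊗ₜ n + m ⊗ₜ (gen D i * n) -
      (rootS D i • (gen D i * m)) ⊗ₜ (gen D i * n) := rfl

theorem gen_mul_smul (i : I) (l : P) (m : NilHecke D) :
    gen D i * (SymmetricAlgebra.ι ℤ P l • m) =
      SymmetricAlgebra.ι ℤ P l • (gen D i * m)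
        - (D.coroot i l : SymmetricAlgebra ℤ P) • (rootS D i • (gen D i * m))
        + (D.coroot i l : SymmetricAlgebra ℤ P) • m := by
  have h := gen_mul_scalar D i l
  simp only [smul_def, ← mul_assoc, h, Realization.reflect, rootS, map_sub, map_zsmul]
  simp only [add_mul, sub_mul, map_intCast, zsmul_eq_mul]

theorem genActPre_smul (i : I) (s : SymmetricAlgebra ℤ P) (m n : NilHecke D) :
    genActPre D i (s • m) n = genActPre D i m (s • n) := by
  induction s using SymmetricAlgebra.induction generalizing m n with
  | algebraMap r =>
    rw [eq_intCast, Int.cast_smul_eq_zsmul, Int.cast_smul_eq_zsmul, map_zsmul, map_zsmul]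
    rfl
  | ι l =>
    simp only [genActPre_apply, gen_mul_smul, TensorProduct.add_tmul, TensorProduct.sub_tmul,
      TensorProduct.tmul_add, TensorProduct.tmul_sub, smul_add, smul_sub,
      TensorProduct.tmul_smul, ← TensorProduct.smul_tmul']
    module
  | mul a b ha hb => rw [mul_smul, ha, hb, ← mul_smul, mul_comm b a]
  | add a b ha hb => rw [add_smul, add_smul, map_add, map_add, AddMonoidHom.add_apply, ha, hb]

/-- The operator by which `A_i` acts on `𝔸 ⊗_S 𝔸`:
`A_i · (m ⊗ n) = A_i m ⊗ n + m ⊗ A_i n - α_i A_i m ⊗ A_i n`. -/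
def genAct (i : I) : TensorSquare D →+ TensorSquare D :=
  TensorProduct.liftAddHom (genActPre D i) (fun s m n => genActPre_smul D i s m n)

theorem genAct_tmul (i : I) (m n : NilHecke D) : genAct D i (m ⊗ₜ n) =
    (gen D i * m) ⊗ₜ n + m ⊗ₜ (gen D i * n) -
      (rootS D i • (gen D i * m)) ⊗ₜ (gen D i * n) := rfl

/-- The operators by which noncommutative polynomials in the generators `s ∈ S` and `A_i` act on
`𝔸 ⊗_S 𝔸`; here `s · (m ⊗ n) = s m ⊗ n`. -/
def freeAct :
    FreeAlgebra ℤ (SymmetricAlgebra ℤ P ⊕ I) →ₐ[ℤ] Module.End ℤ (TensorSquare D) :=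
  FreeAlgebra.lift ℤ (Sum.elim
    (fun s => (DistribSMul.toAddMonoidHom (TensorSquare D) s).toIntLinearMap)
    (fun i => (genAct D i).toIntLinearMap))

/-- The action of `a ∈ 𝔸` on `𝔸 ⊗_S 𝔸`, computed by expressing `a` through the generators.
These operators satisfy the relations of `𝔸`, so the expression of `a` does not matter. -/
def act (a : NilHecke D) : Module.End ℤ (TensorSquare D) :=
  freeAct D (Function.surjInv (mk_surjective D) a)

/-- The coproduct `Δ(a) = a · (1 ⊗ 1)`. -/
def coproduct (a : NilHecke D) : TensorSquare D := act D a (1 ⊗ₜ 1)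

/-- The coordinates `a_{x,y} ∈ S` of an element of `𝔸 ⊗_S 𝔸` in its `S`-basis `A_x ⊗ A_y`. -/
def coords (t : TensorSquare D) : C.Weyl × C.Weyl →₀ SymmetricAlgebra ℤ P :=
  Function.invFun
    (Finsupp.linearCombination (SymmetricAlgebra ℤ P)
      (fun p : C.Weyl × C.Weyl => elt D p.1 ⊗ₜ[SymmetricAlgebra ℤ P] elt D p.2)) t

/-- Evaluation at zero `φ₀ : S → ℤ`. -/
def evalZero (P : Type*) [AddCommGroup P] : SymmetricAlgebra ℤ P →ₐ[ℤ] ℤ :=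
  SymmetricAlgebra.algebraMapInv

/-- `φ₀⁽²⁾(∑ a_{x,y} A_x ⊗ A_y) = ∑ φ₀(a_{x,y}) A_x ⊗ A_y`, with values in `𝔸₀ ⊗_ℤ 𝔸₀`. -/
def phiZeroTwo (t : TensorSquare D) : NilCoxeter C ⊗[ℤ] NilCoxeter C :=
  (coords D t).sum fun p s => evalZero P s • (NilCoxeter.elt C p.1 ⊗ₜ[ℤ] NilCoxeter.elt C p.2)

end NilHecke

/-! ### Embedded subwords -/

/-- An embedded subword of length at least two of a word with `n` letters: a set of positions. -/
abbrev Subword (n : ℕ) : Type := {p : Finset (Fin n) // 2 ≤ p.card}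

theorem Subword.nonempty {n : ℕ} (p : Subword n) : p.1.Nonempty :=
  Finset.card_pos.mp (lt_of_lt_of_le two_pos p.2)

/-- The position of the first letter. -/
def Subword.first {n : ℕ} (p : Subword n) : Fin n := p.1.min' p.nonempty

/-- The position of the last letter. -/
def Subword.last {n : ℕ} (p : Subword n) : Fin n := p.1.max' p.nonempty

/-- The word formed by the letters of `v` at a set of positions, in the order of `v`. -/
def subwordAt (v : List I) (p : Finset (Fin v.length)) : List I :=
  (p.sort (· ≤ ·)).map v.get

/-- The tuples `[v⁽¹⁾, …, v⁽ᵏ⁾]` with first letters `x_i` and last letters `y_i` such that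
`v⁽ⁱ⁾` avoids `x_1, …, x_{i-1}`, such that `y_1 ⋯ y_k` is a subword (its letters are at increasing
positions), and such that no `x_i` equals a `y_j`. -/
def IsAdmissible {n k : ℕ} (T : Fin k → Subword n) : Prop :=
  (∀ i j, j < i → (T j).first ∉ (T i).1) ∧
  StrictMono (fun i => (T i).last) ∧
  ∀ i j, (T i).first ≠ (T j).last

open Classical in
/-- The set of all admissible tuples of subwords of a word with `n` letters. Only lengths `k ≤ n`
occur because the last letters are at strictly increasing positions. -/
def admissibleTuples (n : ℕ) : Finset (Σ k : Fin (n + 1), Fin k → Subword n) :=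
  Finset.univ.filter fun T => IsAdmissible T.2

/-- The set `x = {x_1, …, x_k}` of first letters. -/
def firsts {n k : ℕ} (T : Fin k → Subword n) : Finset (Fin n) :=
  Finset.univ.image fun i => (T i).first

/-- The set `y = {y_1, …, y_k}` of last letters. -/
def lasts {n k : ℕ} (T : Fin k → Subword n) : Finset (Fin n) :=
  Finset.univ.image fun i => (T i).last

/-- `b_u = ∏ b_{u_i u_{i+1}}` for a word `u`, where `b_ij = -a_ij`. -/
def bWord (C : CartanDatum I) : List I → ℤ
  | [] => 1
  | [_] => 1
  | i :: j :: u => -C.a i j * bWord C (j :: u)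

/-- `b_𝐯 = ∏ b_{v⁽ⁱ⁾}` for a tuple of embedded subwords of `v`. -/
def bTuple (C : CartanDatum I) (v : List I) {k : ℕ} (T : Fin k → Subword v.length) : ℤ :=
  ∏ i, bWord C (subwordAt v (T i).1)

end AffineNilHecke

end

/-! Expand `Δ(A_v)` one letter at a time. On a term `s (m ⊗ n)` the generator `A_i` produces `s_i(s)
(A_i m ⊗ n + m ⊗ A_i n - α_i A_i m ⊗ A_i n) + ∂_i(s) m ⊗ n`, with `∂_i = α_i⁻¹ (1 - s_i)`. So each
position of `v` acts on the left factor, on the right factor, on both (set `Y`, with a factor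
`-α_i`), or on the coefficient by `∂_i` (set `X`). This is `NilHecke.coproduct_wordProduct`; the
coefficient belonging to `X` and `Y` is a product of reflections, divided differences and
multiplications by `-α_i`, applied to `1`.

It remains to evaluate this coefficient at `0` (`evalZero_positionOps`). Take the leftmost `y ∈ Y`
and move its root to the left by the twisted Leibniz rule (`positionOps_mul`). The term in which no
`∂` hits the root vanishes at `0`. Otherwise one `x ∈ X` left of `y` hits it; the root has by then
passed the reflections strictly between `x` and `y`, and it is reflected also at the other positions
of `X`, since `∂(l g) = ∂(l) g + s(l) ∂(g)`. Expanding these reflections turns `-⟨α_x^∨, ⋯ α_y⟩`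
into the sum of `b` over all subwords from `x` to `y` (`weightOps_root`, `sum_bWord_eq`). Position
`x` acts afterwards as the identity and is put into a set `Z` of frozen positions. This is why later
subwords avoid exactly the earlier first letters. Taking the elements of `Y` in increasing order
gives the admissible tuples.

Before that, `Δ` and `φ₀⁽²⁾` must be shown to behave as expected. Exact orders of the `s_i s_j` come
from actions on weights, and then Matsumoto's theorem makes `A_w` well defined and kills nonreduced
words. Over the fraction field of `S` the operators `α_i⁻¹ (1 - s_i)` act on functions on `W` and on
`W × W`. They satisfy the nilHecke relations, the braid relation being the hard one
(`demazure_braid_regular`). A triangularity argument on `W` gives independence of the `A_w`, and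
functions on `W × W` give a faithful model of the tensor square in which the action is the diagonal
one. -/

noncomputable section

namespace AffineNilHecke

open CoxeterSystem

/-! ### Exchange condition, Matsumoto's theorem, vanishing of nonreduced words -/

section Coxeter

variable {B W : Type*} [Group W] {M : CoxeterMatrix B} (cs : CoxeterSystem M W)

theorem end_mul_apply {X : Type*} (f g : Function.End X) (x : X) : (f * g) x = f (g x) := rfl

theorem end_one_apply {X : Type*} (x : X) : (1 : Function.End X) x = x := rfl

open Classical in
/-- The action of a simple reflection on pairs (group element, sign) which underlies the exchange
condition: conjugation, with a sign change exactly at the simple reflection itself. -/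
def signedConj (i : B) : Function.End (W × ZMod 2) := fun p =>
  (cs.simple i * p.1 * cs.simple i, p.2 + if p.1 = cs.simple i then 1 else 0)

theorem simple_mul_pow_comm (i j : B) (k : ℕ) :
    cs.simple j * (cs.simple i * cs.simple j) ^ k =
      (cs.simple j * cs.simple i) ^ k * cs.simple j := by
  induction k with
  | zero => simp
  | succ k ih => rw [pow_succ, ← mul_assoc, ih, pow_succ]; simp only [mul_assoc]

theorem mul_pow_cancel (i j : B) (k : ℕ) :
    (cs.simple j * cs.simple i) ^ k * (cs.simple i * cs.simple j) ^ k = 1 := by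
  have : (cs.simple j * cs.simple i) = (cs.simple i * cs.simple j)⁻¹ := by simp
  rw [this, inv_pow, inv_mul_cancel]

-- The elements `(s_j s_i)^r s_j` with `r < 2k` are the right inversion sequence of the word `(i
-- j)^k`; the sign counts how often `p.1` occurs among them.
open Classical in
theorem signedConj_pow (i j : B) (k : ℕ) (p : W × ZMod 2) :
    ((signedConj cs i * signedConj cs j) ^ k) p =
      ((cs.simple i * cs.simple j) ^ k * p.1 * (cs.simple j * cs.simple i) ^ k,
        p.2 + ∑ r ∈ Finset.range (2 * k),
          if p.1 = (cs.simple j * cs.simple i) ^ r * cs.simple j then 1 else 0) := by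
  induction k with
  | zero => simp [end_one_apply]
  | succ k ih =>
    rw [pow_succ', end_mul_apply, ih, end_mul_apply]
    set g := (cs.simple i * cs.simple j) with hg
    set g' := (cs.simple j * cs.simple i) with hg'
    -- The two new sign conditions, for `s_j` and then for `s_i`, are pulled back through
    -- conjugation by `g ^ k`; they become the terms `r = 2k` and `r = 2k + 1`.
    have e1 : (g ^ k * p.1 * g' ^ k = cs.simple j) ↔ p.1 = g' ^ (2 * k) * cs.simple j := by
      have h1 := mul_pow_cancel cs i j k
      have h2 := mul_pow_cancel cs j i k
      rw [← hg, ← hg'] at h1 h2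
      have h3 := simple_mul_pow_comm cs i j k
      rw [← hg, ← hg'] at h3
      constructor
      · intro h
        calc p.1 = (g' ^ k * g ^ k) * p.1 * (g' ^ k * g ^ k) := by rw [h1]; simp
          _ = g' ^ k * (g ^ k * p.1 * g' ^ k) * g ^ k := by simp only [mul_assoc]
          _ = g' ^ k * (cs.simple j * g ^ k) := by rw [h, mul_assoc]
          _ = _ := by rw [h3, ← mul_assoc, ← pow_add, two_mul]
      · intro h
        rw [h, two_mul, pow_add, mul_assoc (g' ^ k), ← h3]
        calc g ^ k * (g' ^ k * (cs.simple j * g ^ k)) * g' ^ k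
            = (g ^ k * g' ^ k) * cs.simple j * (g ^ k * g' ^ k) := by simp only [mul_assoc]
          _ = _ := by rw [h2]; simp
    have e2 : (cs.simple j * (g ^ k * p.1 * g' ^ k) * cs.simple j = cs.simple i) ↔
        p.1 = g' ^ (2 * k + 1) * cs.simple j := by
      have h1 := mul_pow_cancel cs i j k
      have h2 := mul_pow_cancel cs j i k
      rw [← hg, ← hg'] at h1 h2
      have h3 := simple_mul_pow_comm cs i j k
      rw [← hg, ← hg'] at h3
      constructor
      · intro h
        calc p.1 = (g' ^ k * g ^ k) * p.1 * (g' ^ k * g ^ k) := by rw [h1]; simp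
          _ = g' ^ k * (cs.simple j * (cs.simple j * (g ^ k * p.1 * g' ^ k) * cs.simple j)) *
              (cs.simple j * g ^ k) := by simp [mul_assoc]
          _ = g' ^ k * g' * (g' ^ k * cs.simple j) := by rw [h, h3]
          _ = _ := by rw [← pow_succ, ← mul_assoc, ← pow_add]; congr 2; ring
      · intro h
        have : g' ^ (2 * k + 1) * cs.simple j = g' ^ k * g' * (cs.simple j * g ^ k) := by
          rw [h3, ← mul_assoc, ← pow_succ, ← pow_add]; congr 2; ring
        rw [h, this]
        calc cs.simple j * (g ^ k * (g' ^ k * g' * (cs.simple j * g ^ k)) * g' ^ k) * cs.simple j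
            = cs.simple j * ((g ^ k * g' ^ k) * g' * cs.simple j * (g ^ k * g' ^ k)) *
                cs.simple j := by simp only [mul_assoc]
          _ = _ := by rw [h2, hg']; simp [mul_assoc]
    simp only [signedConj, e1, e2]
    ext
    · simp only [pow_succ', hg, hg']
      have := pow_succ' (cs.simple j * cs.simple i) k
      rw [pow_succ] at this
      simp only [← mul_assoc] at this ⊢
      simp only [mul_assoc] at this ⊢
      rw [this]
    · rw [show 2 * (k + 1) = 2 * k + 1 + 1 by ring, Finset.sum_range_succ, Finset.sum_range_succ]
      simp only [add_assoc]

/-- For `k = m_ij` the list of `2k` reflections has period `m_ij`, so every reflection is counted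
twice and the sign is unchanged modulo 2. For `m_ij = 0` there is nothing to count. -/
theorem signedConj_isLiftable : M.IsLiftable (signedConj cs) := by
  classical
  intro i j
  funext p
  rw [signedConj_pow]
  have h1 := cs.simple_mul_simple_pow i j
  have h2 := cs.simple_mul_simple_pow' i j
  rw [h1, h2, two_mul, Finset.sum_range_add]
  simp only [pow_add, h2, one_mul]
  ext
  · simp [end_one_apply]
  · simp [end_one_apply, CharTwo.add_self_eq_zero]

/-- The signed conjugation action of the whole group. -/
def signedConjHom : W →* Function.End (W × ZMod 2) :=
  cs.lift ⟨signedConj cs, signedConj_isLiftable cs⟩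

open Classical in
theorem signedConjHom_wordProd (ω : List B) (p : W × ZMod 2) :
    signedConjHom cs (cs.wordProd ω) p =
      (cs.wordProd ω * p.1 * (cs.wordProd ω)⁻¹,
        p.2 + ((cs.rightInvSeq ω).count p.1 : ZMod 2)) := by
  induction ω with
  | nil => simp [end_one_apply]
  | cons i ω ih =>
    rw [wordProd_cons, map_mul, end_mul_apply, ih, signedConjHom,
      lift_apply_simple, signedConj, rightInvSeq, List.count_cons]
    ext
    · simp [mul_assoc]
    · have : cs.wordProd ω * p.1 * (cs.wordProd ω)⁻¹ = cs.simple i ↔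
          ((cs.wordProd ω)⁻¹ * cs.simple i * cs.wordProd ω == p.1) = true := by
        rw [beq_iff_eq]
        constructor
        · intro h; rw [← h]; group
        · intro h; rw [← h]; group
      simp only [this]
      push_cast
      rw [add_assoc]

/-- The exchange condition. -/
theorem mem_rightInvSeq_of_isRightDescent {ω : List B} {i : B}
    (h : cs.IsRightDescent (cs.wordProd ω) i) : cs.simple i ∈ cs.rightInvSeq ω := by
  classical
  by_contra hn
  -- The sign of `w s_i` at the reflection `s_i` is computed in two ways. The factor `s_i`
  -- contributes 1 and `w` contributes 0 by assumption, so `s_i` occurs in the inversion sequence of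
  -- a reduced word of `w s_i`. Hence `w s_i s_i = w` is shorter than `w s_i`, contrary to the
  -- descent.
  obtain ⟨ω', hω', h'⟩ := cs.exists_isReduced (cs.wordProd ω * cs.simple i)
  have h0 : signedConjHom cs (cs.wordProd ω) (cs.simple i, 0) =
      (cs.wordProd ω * cs.simple i * (cs.wordProd ω)⁻¹, 0) := by
    rw [signedConjHom_wordProd]; simp [List.count_eq_zero_of_not_mem hn]
  have h1 : signedConjHom cs (cs.wordProd ω') (cs.simple i, 0) =
      (cs.wordProd ω * cs.simple i * (cs.wordProd ω)⁻¹, 1) := by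
    rw [← h', map_mul, end_mul_apply]
    have : signedConjHom cs (cs.simple i) (cs.simple i, 0) = (cs.simple i, 1) := by
      rw [signedConjHom, lift_apply_simple, signedConj]; simp
    rw [this, signedConjHom_wordProd]; simp [List.count_eq_zero_of_not_mem hn]
  rw [signedConjHom_wordProd] at h1
  have h2 : cs.simple i ∈ cs.rightInvSeq ω' := by
    by_contra hc
    have := congrArg Prod.snd h1
    simp [List.count_eq_zero_of_not_mem hc] at this
  have h3 := (cs.isRightInversion_of_mem_rightInvSeq hω' h2).2
  rw [← h'] at h3
  simp only [simple_mul_simple_cancel_right] at h3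
  exact absurd h (not_lt_of_gt h3)

/-- Each letter appended conjugates the earlier inversions and raises their exponent by one. The
bound on `q` is what excludes an exchange inside an alternating tail below. -/
theorem exists_pow_of_mem_rightInvSeq_alternatingWord (i j : B) (k : ℕ) {t : W}
    (ht : t ∈ cs.rightInvSeq (alternatingWord j i k)) :
    ∃ q < k, t = (cs.simple i * cs.simple j) ^ q * cs.simple i := by
  induction k generalizing i j t with
  | zero => simp [alternatingWord] at ht
  | succ k ih =>
    rw [alternatingWord_succ, rightInvSeq_concat, List.concat_eq_append, List.mem_append] at ht
    rcases ht with ht | ht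
    · obtain ⟨t', ht', rfl⟩ := List.mem_map.mp ht
      obtain ⟨q, hq, rfl⟩ := ih j i ht'
      refine ⟨q + 1, by omega, ?_⟩
      rw [MulAut.conj_apply, ← mul_assoc, simple_mul_pow_comm, inv_simple, pow_succ]
      simp only [mul_assoc]
    · exact ⟨0, by omega, by simpa using ht⟩

theorem rightInvSeq_append (u v : List B) : cs.rightInvSeq (u ++ v) =
    (cs.rightInvSeq u).map (fun t => (cs.wordProd v)⁻¹ * t * cs.wordProd v) ++
      cs.rightInvSeq v := by
  induction u with
  | nil => simp
  | cons i u ih =>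
    simp only [List.cons_append, rightInvSeq, ih, wordProd_append, mul_inv_rev, List.map_cons,
      mul_assoc]

theorem isReduced_of_length_le {u : List B} {w : W} (h : cs.wordProd u = w)
    (h' : u.length ≤ cs.length w) : cs.IsReduced u :=
  le_antisymm (cs.length_wordProd_le u) (h ▸ h')

/-- If `i ≠ j` are right descents of `w` then `w` has a reduced word which ends in an alternating
word of length `k`, as long as `s_i s_j` has no smaller order. -/
theorem exists_isReduced_append_alternatingWord {w : W} {i j : B}
    (hi : cs.IsRightDescent w i) (hj : cs.IsRightDescent w j) (k : ℕ)
    (hk : ∀ d, 0 < d → d < k → (cs.simple i * cs.simple j) ^ d ≠ 1) :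
    ∃ u, cs.IsReduced (u ++ alternatingWord i j k) ∧
      cs.wordProd (u ++ alternatingWord i j k) = w := by
  induction k generalizing i j with
  | zero =>
    obtain ⟨u, hu, h⟩ := cs.exists_isReduced w
    exact ⟨u, by simpa [alternatingWord] using hu, by simpa [alternatingWord] using h.symm⟩
  | succ k ih =>
    obtain ⟨u, hu, h⟩ := ih hj hi (fun d h0 hd h1 => hk d h0 (by omega) (by
      have := mul_pow_cancel cs i j d
      rwa [h1, one_mul] at this))
    -- The exchange for `s_j` deletes a letter either from `u`, and then `j` can be appended to the
    -- tail at no cost in length, or from the tail, and then `(s_i s_j)^(q+1) = 1` with `0 < q + 1 <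
    -- k + 1`.
    have hmem := mem_rightInvSeq_of_isRightDescent cs (h ▸ hj)
    rw [rightInvSeq_append, List.mem_append] at hmem
    rcases hmem with hmem | hmem
    · obtain ⟨t, ht, htj⟩ := List.mem_map.mp hmem
      obtain ⟨p, hp, rfl⟩ := List.mem_iff_getElem.mp ht
      have hp' : p < u.length := by simpa using hp
      have key := cs.wordProd_mul_getD_rightInvSeq u p
      rw [List.getD_eq_getElem _ 1 hp] at key
      set t := (cs.rightInvSeq u)[p]
      have hw : cs.wordProd (u.eraseIdx p ++ alternatingWord i j (k + 1)) = w := by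
        rw [wordProd_append, ← key, alternatingWord_succ, wordProd_concat, ← htj, ← h,
          wordProd_append]
        have ht2 : t * t = 1 :=
          (cs.isReflection_of_mem_rightInvSeq u (List.getElem_mem hp)).mul_self
        calc _ = cs.wordProd u * (t * t) * cs.wordProd (alternatingWord j i k) := by group
          _ = _ := by rw [ht2, mul_one]
      refine ⟨u.eraseIdx p, isReduced_of_length_le cs hw ?_, hw⟩
      rw [← h, hu.eq]
      have := List.length_eraseIdx_add_one hp'
      simp only [List.length_append, length_alternatingWord]
      omega
    · obtain ⟨q, hq, h1⟩ := exists_pow_of_mem_rightInvSeq_alternatingWord cs i j k hmem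
      refine absurd ?_ (hk (q + 1) (by omega) (by omega))
      rw [pow_succ, ← mul_assoc, ← h1, simple_mul_simple_self]

/-- The hypothesis that every product `s_i s_j` has exactly the order given by the Coxeter
matrix. -/
def HasExactOrders : Prop := ∀ i j, i ≠ j → ∀ d, 0 < d → (M i j ≠ 0 → d < M i j) →
  (cs.simple i * cs.simple j) ^ d ≠ 1

variable {cs}

theorem isReduced_append_left {u v : List B} (h : cs.IsReduced (u ++ v)) : cs.IsReduced u := by
  have := h.take u.length
  simpa using this

theorem wordProduct_append {R : Type*} [Monoid R] (x : B → R) (u v : List B) :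
    wordProduct x (u ++ v) = wordProduct x u * wordProduct x v := by simp [wordProduct]

theorem wordProduct_cons {R : Type*} [Monoid R] (x : B → R) (i : B) (v : List B) :
    wordProduct x (i :: v) = x i * wordProduct x v := by simp [wordProduct]

theorem wordProduct_nil {R : Type*} [Monoid R] (x : B → R) :
    wordProduct x [] = 1 := by simp [wordProduct]

theorem wordProduct_map {R R' F : Type*} [Monoid R] [Monoid R'] [FunLike F R R']
    [MonoidHomClass F R R'] (f : F) (x : B → R)
    (u : List B) : f (wordProduct x u) = wordProduct (fun i => f (x i)) u := by
  simp only [wordProduct, map_list_prod, List.map_map]; rfl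

theorem isRightDescent_of_isReduced_append {u : List B} {i : B}
    (h : cs.IsReduced (u ++ [i])) : cs.IsRightDescent (cs.wordProd (u ++ [i])) i := by
  have h1 := isReduced_append_left h
  rw [IsRightDescent, h.eq, ← List.concat_eq_append, wordProd_concat,
    simple_mul_simple_cancel_right, h1.eq]
  simp

/-- Matsumoto's theorem: elements of a monoid which satisfy the braid relations have the same
product along any two reduced words of a group element. -/
theorem wordProduct_eq_of_isReduced {R : Type*} [Monoid R] {x : B → R} (hcs : HasExactOrders cs)
    (hx : ∀ i j, i ≠ j → M i j ≠ 0 → wordProduct x (alternatingWord i j (M i j)) =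
      wordProduct x (alternatingWord j i (M i j))) {z z' : List B}
    (hz : cs.IsReduced z) (hz' : cs.IsReduced z') (h : cs.wordProd z = cs.wordProd z') :
    wordProduct x z = wordProduct x z' := by
  have hlen : z.length = z'.length := by rw [← hz.eq, h, hz'.eq]
  induction hn : z.length generalizing z z' with
  | zero =>
    obtain rfl := List.eq_nil_of_length_eq_zero hn
    obtain rfl := List.eq_nil_of_length_eq_zero (hlen ▸ hn)
    rfl
  | succ n ih =>
    -- Two words with the same last letter reduce to the induction hypothesis by cancelling it.
    have same : ∀ {u u' : List B} {i : B}, cs.IsReduced (u ++ [i]) → cs.IsReduced (u' ++ [i]) →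
        cs.wordProd (u ++ [i]) = cs.wordProd (u' ++ [i]) → (u ++ [i]).length = n + 1 →
        wordProduct x (u ++ [i]) = wordProduct x (u' ++ [i]) := by
      intro u u' i h1 h2 h3 h4
      have h5 : cs.wordProd u = cs.wordProd u' := by
        simpa [wordProd_append] using h3
      have h6 := isReduced_append_left h1
      have h7 := isReduced_append_left h2
      rw [wordProduct_append, wordProduct_append, ih h6 h7 h5
        (by rw [← h6.eq, h5, h7.eq]) (by simpa using h4)]
    obtain ⟨u, i, rfl⟩ : ∃ u i, z = u ++ [i] :=
      ⟨_, _, (List.dropLast_concat_getLast (by rintro rfl; simp at hn)).symm⟩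
    obtain ⟨u', j, rfl⟩ : ∃ u i, z' = u ++ [i] :=
      ⟨_, _, (List.dropLast_concat_getLast (by rintro rfl; simp at hlen)).symm⟩
    by_cases hij : i = j
    · subst hij
      exact same hz hz' h hn
    · have di := isRightDescent_of_isReduced_append hz
      have dj := isRightDescent_of_isReduced_append hz'
      rw [← h] at dj
      set w := cs.wordProd (u ++ [i]) with hw
      -- If the order were infinite, `w` would have a reduced word with an alternating tail longer
      -- than `w` itself.
      have hm : M i j ≠ 0 := by
        intro hm
        obtain ⟨a, ha, ha'⟩ := exists_isReduced_append_alternatingWord cs di dj (cs.length w + 1)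
          (fun d h0 _ => hcs i j hij d h0 (fun h => absurd hm h))
        have := ha.eq
        rw [ha'] at this
        simp only [List.length_append, length_alternatingWord] at this
        omega
      obtain ⟨a, ha, ha'⟩ := exists_isReduced_append_alternatingWord cs di dj (M i j)
          (fun d h0 hd => hcs i j hij d h0 (fun _ => hd))
      have hb' : cs.wordProd (a ++ alternatingWord j i (M i j)) = w := by
        have := cs.wordProd_braidWord_eq i j
        rw [braidWord, braidWord, M.symmetric j i] at this
        rw [wordProd_append, ← this, ← wordProd_append, ha']
      have hb : cs.IsReduced (a ++ alternatingWord j i (M i j)) := by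
        apply isReduced_of_length_le cs hb'
        rw [← ha', ha.eq]
        simp
      have hab : wordProduct x (a ++ alternatingWord i j (M i j)) =
          wordProduct x (a ++ alternatingWord j i (M i j)) := by
        rw [wordProduct_append, wordProduct_append, hx i j hij hm]
      have hlast : ∀ i j m, m ≠ 0 → ∃ b : List B, alternatingWord i j m = b ++ [j] := by
        intro i j m hm
        obtain ⟨m, rfl⟩ := Nat.exists_eq_succ_of_ne_zero hm
        exact ⟨_, by rw [alternatingWord_succ, List.concat_eq_append]⟩
      obtain ⟨b, hb1⟩ := hlast i j _ hm
      obtain ⟨b', hb2⟩ := hlast j i _ hm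
      rw [hb1, ← List.append_assoc] at ha ha' hab
      rw [hb2, ← List.append_assoc] at hb hb' hab
      -- The two words ending in the two braid words link `z` to `z'`: the outer steps compare words
      -- with equal last letters, the middle one is the braid relation.
      calc _ = _ := same hz hb (by rw [hb']) hn
        _ = _ := hab.symm
        _ = _ := same ha hz' (by rw [ha', h]) (by rw [← ha.eq, ha', ← hn, hz.eq])

/-- Under the nilCoxeter relations, products along words which are not reduced vanish. -/
theorem wordProduct_eq_zero {R : Type*} [MonoidWithZero R] {x : B → R} (hcs : HasExactOrders cs)
    (hx : ∀ i j, i ≠ j → M i j ≠ 0 → wordProduct x (alternatingWord i j (M i j)) =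
      wordProduct x (alternatingWord j i (M i j))) (hsq : ∀ i, x i * x i = 0) {z : List B}
    (hz : ¬ cs.IsReduced z) : wordProduct x z = 0 := by
  induction z using List.reverseRecOn with
  | nil => simp [CoxeterSystem.IsReduced] at hz
  | append_singleton u i ih =>
    rw [wordProduct_append]
    by_cases hu : cs.IsReduced u
    -- Here `u` is reduced and `u i` is not, so `u` has another reduced word ending in `i`, and the
    -- square of `x i` appears.
    · obtain ⟨e, he, he'⟩ := cs.exists_isReduced (cs.wordProd u * cs.simple i)
      have h1 : cs.length (cs.wordProd u * cs.simple i) + 1 = cs.length (cs.wordProd u) := by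
        rcases cs.length_mul_simple (cs.wordProd u) i with h | h
        · refine absurd ?_ hz
          rw [CoxeterSystem.IsReduced, ← List.concat_eq_append, wordProd_concat, h, hu.eq]
          simp
        · exact h
      have h2 : cs.wordProd (e ++ [i]) = cs.wordProd u := by
        rw [← List.concat_eq_append, wordProd_concat, ← he', simple_mul_simple_cancel_right]
      have h3 : cs.IsReduced (e ++ [i]) := by
        apply isReduced_of_length_le cs h2
        rw [← h1, he', he.eq]; simp
      rw [wordProduct_eq_of_isReduced hcs hx hu h3 h2.symm, wordProduct_append]
      simp [wordProduct, mul_assoc, hsq]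
    · rw [ih hu, zero_mul]

end Coxeter

end AffineNilHecke

end

noncomputable section

namespace AffineNilHecke

open CoxeterSystem

/-! ### Weyl group action on weights and exact orders of `s_i s_j` -/

section Reflections

variable {I : Type*} {C : CartanDatum I}

theorem CartanDatum.coxeterMatrix_of_ne {i j : I} (h : i ≠ j) :
    C.coxeterMatrix i j = braidOrder (C.a i j * C.a j i) := by
  change (Matrix.of _) i j = _
  simp [h]

theorem CartanDatum.four_le_of_order_eq_zero {i j : I} (h : i ≠ j)
    (hm : C.coxeterMatrix i j = 0) : 4 ≤ C.a i j * C.a j i := by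
  rw [coxeterMatrix_of_ne h, braidOrder] at hm
  have h1 := C.nonpos i j h
  have h2 := C.nonpos j i h.symm
  have h3 := mul_nonneg_of_nonpos_of_nonpos h1 h2
  split_ifs at hm
  omega

theorem CartanDatum.finite_order_cases {i j : I} (h : i ≠ j) (hm : C.coxeterMatrix i j ≠ 0) :
    (C.coxeterMatrix i j = 2 ∧ C.a i j = 0 ∧ C.a j i = 0) ∨
    (C.coxeterMatrix i j = 3 ∧ C.a i j = -1 ∧ C.a j i = -1) ∨
    (C.coxeterMatrix i j = 4 ∧ C.a i j = -1 ∧ C.a j i = -2) ∨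
    (C.coxeterMatrix i j = 4 ∧ C.a i j = -2 ∧ C.a j i = -1) ∨
    (C.coxeterMatrix i j = 6 ∧ C.a i j = -1 ∧ C.a j i = -3) ∨
    (C.coxeterMatrix i j = 6 ∧ C.a i j = -3 ∧ C.a j i = -1) := by
  rw [coxeterMatrix_of_ne h] at *
  have h1 := C.nonpos i j h
  have h2 := C.nonpos j i h.symm
  have h3 := C.neg_iff i j h
  generalize C.a i j = a at *
  generalize C.a j i = b at *
  rcases eq_or_lt_of_le h1 with rfl | ha
  · have : b = 0 := by omega
    subst this
    simp [braidOrder]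
  · have hb := h3.mp ha
    have key : a * b ≤ 3 := by
      by_contra hc
      refine hm ?_
      simp only [braidOrder]
      split_ifs <;> first | rfl | omega
    have ha3 : -3 ≤ a := by nlinarith
    have hb3 : -3 ≤ b := by nlinarith
    interval_cases a <;> interval_cases b <;> simp_all [braidOrder]

variable {P : Type*} [AddCommGroup P] (D : Realization C P)

theorem Realization.coroot_reflect (k i : I) (l : P) :
    D.coroot k (D.reflect i l) = D.coroot k l - D.coroot i l * C.a k i := by
  simp [reflect, D.pairing]

theorem Realization.reflect_reflect (i : I) (l : P) : D.reflect i (D.reflect i l) = l := by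
  rw [reflect, coroot_reflect, C.diag, reflect]
  module

/-- A simple reflection as a linear automorphism of the weight lattice. -/
def Realization.reflectEquiv (i : I) : P ≃ₗ[ℤ] P :=
  LinearEquiv.ofInvolutive
    (LinearMap.id - (D.coroot i).smulRight (D.root i) : P →ₗ[ℤ] P) fun l => D.reflect_reflect i l

theorem Realization.reflectEquiv_apply (i : I) (l : P) :
    D.reflectEquiv i l = D.reflect i l := rfl

/-- How `s_i s_j` changes the coordinates `(x, y)` of `λ + x α_i + y α_j`, where `c = ⟨α_i^∨, λ⟩`,
`c' = ⟨α_j^∨, λ⟩`. -/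
def rootStep (a b c c' : ℤ) (p : ℤ × ℤ) : ℤ × ℤ :=
  (-c - p.1 - (-c' - p.1 * b - p.2) * a, -c' - p.1 * b - p.2)

theorem Realization.reflectEquiv_mul_pow_apply (i j : I) (l : P) (k : ℕ) :
    ((D.reflectEquiv i * D.reflectEquiv j) ^ k) l =
      l + ((rootStep (C.a i j) (C.a j i) (D.coroot i l) (D.coroot j l))^[k] (0, 0)).1 • D.root i
        + ((rootStep (C.a i j) (C.a j i) (D.coroot i l) (D.coroot j l))^[k] (0, 0)).2 •
          D.root j := by
  induction k with
  | zero => simp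
  | succ k ih =>
    rw [pow_succ', LinearEquiv.mul_apply, ih, Function.iterate_succ_apply']
    set p := (rootStep (C.a i j) (C.a j i) (D.coroot i l) (D.coroot j l))^[k] (0, 0)
    simp only [LinearEquiv.mul_apply, reflectEquiv_apply, rootStep, reflect, map_add, map_sub,
      map_smul, D.pairing, C.diag]
    module

/-- How `s_i s_j` changes the pairings `(⟨α_i^∨, λ⟩, ⟨α_j^∨, λ⟩)`. -/
def pairingStep (a b : ℤ) (p : ℤ × ℤ) : ℤ × ℤ :=
  (-(p.1 - p.2 * a), -p.2 - (p.1 - p.2 * a) * b)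

theorem Realization.coroot_reflectEquiv_mul_pow (i j : I) (l : P) (k : ℕ) :
    (D.coroot i (((D.reflectEquiv i * D.reflectEquiv j) ^ k) l),
      D.coroot j (((D.reflectEquiv i * D.reflectEquiv j) ^ k) l)) =
      (pairingStep (C.a i j) (C.a j i))^[k] (D.coroot i l, D.coroot j l) := by
  induction k with
  | zero => simp
  | succ k ih =>
    rw [pow_succ', LinearEquiv.mul_apply, Function.iterate_succ_apply', ← ih]
    simp only [LinearEquiv.mul_apply, reflectEquiv_apply, coroot_reflect, C.diag, pairingStep]
    ext <;> ring

theorem Realization.reflectEquiv_mul_self (i : I) :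
    D.reflectEquiv i * D.reflectEquiv i = 1 := by
  ext l; simp [LinearEquiv.mul_apply, reflectEquiv_apply, reflect_reflect]

/-- The roots may be dependent, so the relation is checked on formal coordinates of `λ + x α_i + y
α_j`: in each of the six finite cases `m_ij` steps lead from `(0, 0)` back to `(0, 0)`, identically
in the two pairings of `λ`. -/
theorem Realization.reflectEquiv_isLiftable :
    C.coxeterMatrix.IsLiftable D.reflectEquiv := by
  intro i j
  by_cases h : i = j
  · subst h
    rw [C.coxeterMatrix.diagonal, pow_one, reflectEquiv_mul_self]
  by_cases hm : C.coxeterMatrix i j = 0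
  · rw [hm, pow_zero]
  ext l
  change ((D.reflectEquiv i * D.reflectEquiv j) ^ (C.coxeterMatrix i j)) l = l
  rw [reflectEquiv_mul_pow_apply]
  suffices (rootStep (C.a i j) (C.a j i) (D.coroot i l) (D.coroot j l))^[C.coxeterMatrix i j]
      (0, 0) = (0, 0) by rw [this]; simp
  rcases C.finite_order_cases h hm with h | h | h | h | h | h <;> obtain ⟨h1, h2, h3⟩ := h <;>
    rw [h1, h2, h3] <;> simp only [Function.iterate_succ_apply, Function.iterate_zero, id,
      rootStep] <;> ext <;> ring

/-- The action of the Weyl group on the weight lattice. -/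
def Realization.weylHom : C.Weyl →* (P ≃ₗ[ℤ] P) := C.cs.lift ⟨D.reflectEquiv,
  D.reflectEquiv_isLiftable⟩

theorem Realization.weylHom_simple (i : I) : D.weylHom (C.cs.simple i) = D.reflectEquiv i :=
  C.cs.lift_apply_simple _ i

/-- The pairings of `(s_i s_j)^d α_i` with the two coroots already differ from those of `α_i`. Only
Cartan entries enter, so this works in every realization. -/
theorem Realization.weylHom_mul_pow_ne_one {i j : I} (h : i ≠ j) (hm : C.coxeterMatrix i j ≠ 0)
    {d : ℕ} (h0 : 0 < d) (hd : d < C.coxeterMatrix i j) :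
    (D.reflectEquiv i * D.reflectEquiv j) ^ d ≠ 1 := by
  intro h1
  have h2 := D.coroot_reflectEquiv_mul_pow i j (D.root i) d
  rw [h1] at h2
  simp only [LinearEquiv.coe_one, id, D.pairing, C.diag] at h2
  rcases C.finite_order_cases h hm with h | h | h | h | h | h <;> obtain ⟨h3, h4, h5⟩ := h <;>
    rw [h3] at hd <;> rw [h4, h5] at h2 <;> interval_cases d <;>
    simp [Function.iterate_succ_apply, pairingStep] at h2

variable (C) in
/-- The realization by the fundamental weights. -/
def Realization.weights : Realization C (I → ℤ) where
  root j := fun i => C.a i j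
  coroot i := LinearMap.proj i
  pairing _ _ := rfl

theorem pairingStep_ne {a b : ℤ} (ha : a ≤ 0) (hb : b ≤ 0) (hab : 4 ≤ a * b) {d : ℕ} (hd : 0 < d) :
    (pairingStep a b)^[d] (0, 1) ≠ (0, 1) := by
  have ha' : a < 0 := lt_of_le_of_ne ha (by rintro rfl; simp at hab)
  -- The cone given by `c > 0` and `0 ≤ -2p ≤ -a c` is preserved because `a b ≥ 4`, and after one
  -- step `p` is strictly negative, whereas it starts at `0`.
  have key : ∀ d : ℕ, 0 < ((pairingStep a b)^[d] (0, 1)).2 ∧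
      2 * -((pairingStep a b)^[d] (0, 1)).1 ≤ -a * ((pairingStep a b)^[d] (0, 1)).2 ∧
      0 ≤ -((pairingStep a b)^[d] (0, 1)).1 ∧
      (0 < d → 0 < -((pairingStep a b)^[d] (0, 1)).1) := by
    intro d
    induction d with
    | zero => simp; omega
    | succ d ih =>
      rw [Function.iterate_succ_apply']
      generalize (pairingStep a b)^[d] (0, 1) = p at *
      obtain ⟨h1, h2, h3, -⟩ := ih
      obtain ⟨p, c⟩ := p
      simp only [pairingStep] at *
      have e1 : 0 < -a * c := mul_pos (by omega) h1
      have e2 : 4 * c ≤ a * b * c := by nlinarith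
      have e3 : -a * c ≤ 2 * (p - c * a) := by nlinarith
      have e4 : -a * c * -b ≤ 2 * (p - c * a) * -b := mul_le_mul_of_nonneg_right e3 (by omega)
      have e5 : 4 * (p - c * a) ≤ a * b * (p - c * a) :=
        mul_le_mul_of_nonneg_right hab (by nlinarith)
      refine ⟨by nlinarith, by nlinarith, by nlinarith, fun _ => by nlinarith⟩
  intro h
  have := (key d).2.2.2 hd
  rw [h] at this
  simp at this

/-- The realization on `I → ℤ` contains the fundamental weight of `j`, with pairings `(0, 1)`; its
orbit detects infinite order. Finite orders are detected by `α_i`. -/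
theorem CartanDatum.hasExactOrders : HasExactOrders C.cs := by
  classical
  intro i j hij d h0 hd h1
  have h2 := congrArg (Realization.weights C).weylHom h1
  rw [map_pow, map_mul, map_one, Realization.weylHom_simple, Realization.weylHom_simple] at h2
  by_cases hm : C.coxeterMatrix i j = 0
  · have h3 := (Realization.weights C).coroot_reflectEquiv_mul_pow i j (Pi.single j 1) d
    rw [h2] at h3
    simp only [LinearEquiv.coe_one, id, Realization.weights, LinearMap.proj_apply,
      Pi.single_eq_same, Pi.single_eq_of_ne hij] at h3
    exact pairingStep_ne (C.nonpos i j hij) (C.nonpos j i hij.symm)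
      (C.four_le_of_order_eq_zero hij hm) h0 h3.symm
  · exact Realization.weylHom_mul_pow_ne_one _ hij hm h0 (hd hm) h2

theorem Realization.reflectEquiv_ne_one (i : I) : D.reflectEquiv i ≠ 1 := by
  intro h
  have := congrArg (D.coroot i) (LinearEquiv.congr_fun h (D.root i))
  rw [reflectEquiv_apply, coroot_reflect] at this
  simp [D.pairing, C.diag] at this

theorem simple_mul_zpow (i j : I) (k : ℤ) :
    C.cs.simple i * (C.cs.simple i * C.cs.simple j) ^ k =
      (C.cs.simple i * C.cs.simple j) ^ (-k) * C.cs.simple i := by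
  have h : C.cs.simple i * (C.cs.simple i * C.cs.simple j) ^ k * (C.cs.simple i)⁻¹ =
      (C.cs.simple i * (C.cs.simple i * C.cs.simple j) * (C.cs.simple i)⁻¹) ^ k := by
    rw [conj_zpow]
  have h2 : C.cs.simple i * (C.cs.simple i * C.cs.simple j) * (C.cs.simple i)⁻¹ =
      (C.cs.simple i * C.cs.simple j)⁻¹ := by
    simp [-CoxeterMatrix.toCoxeterSystem_simple, ← mul_assoc]
  rw [h2, inv_zpow', mul_inv_eq_iff_eq_mul] at h
  exact h

/-- The subgroup of the Weyl group generated by two simple reflections. -/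
def CartanDatum.dihedral (C : CartanDatum I) (i j : I) : Subgroup C.Weyl :=
  Subgroup.closure {C.cs.simple i, C.cs.simple j}

theorem simple_left_mem_dihedral (i j : I) : C.cs.simple i ∈ C.dihedral i j :=
  Subgroup.subset_closure (by simp)

theorem simple_right_mem_dihedral (i j : I) : C.cs.simple j ∈ C.dihedral i j :=
  Subgroup.subset_closure (by simp)

theorem exists_of_mem_dihedral {i j : I} {u : C.Weyl} (hu : u ∈ C.dihedral i j) :
    ∃ k : ℤ, u = (C.cs.simple i * C.cs.simple j) ^ k ∨
      u = (C.cs.simple i * C.cs.simple j) ^ k * C.cs.simple i := by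
  have hi : ∀ u : C.Weyl, (∃ k : ℤ, u = (C.cs.simple i * C.cs.simple j) ^ k ∨
      u = (C.cs.simple i * C.cs.simple j) ^ k * C.cs.simple i) →
      (∃ k : ℤ, C.cs.simple i * u = (C.cs.simple i * C.cs.simple j) ^ k ∨
      C.cs.simple i * u = (C.cs.simple i * C.cs.simple j) ^ k * C.cs.simple i) := by
    rintro u ⟨k, rfl | rfl⟩
    · exact ⟨-k, Or.inr (simple_mul_zpow i j k)⟩
    · exact ⟨-k, Or.inl (by rw [← mul_assoc, simple_mul_zpow, simple_mul_simple_cancel_right])⟩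
  have hj : ∀ u : C.Weyl, (∃ k : ℤ, u = (C.cs.simple i * C.cs.simple j) ^ k ∨
      u = (C.cs.simple i * C.cs.simple j) ^ k * C.cs.simple i) →
      (∃ k : ℤ, C.cs.simple j * u = (C.cs.simple i * C.cs.simple j) ^ k ∨
      C.cs.simple j * u = (C.cs.simple i * C.cs.simple j) ^ k * C.cs.simple i) := by
    intro u hu
    have : C.cs.simple j * u = C.cs.simple i * ((C.cs.simple i * C.cs.simple j) * u) := by
      rw [mul_assoc, simple_mul_simple_cancel_left]
    rw [this]
    apply hi
    rcases hu with ⟨k, rfl | rfl⟩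
    · exact ⟨1 + k, Or.inl (by rw [zpow_one_add])⟩
    · exact ⟨1 + k, Or.inr (by rw [zpow_one_add]; simp only [mul_assoc])⟩
  have hij : ∀ x ∈ ({C.cs.simple i, C.cs.simple j} : Set C.Weyl), x⁻¹ = x := by
    rintro x (rfl | rfl) <;> rw [inv_simple]
  induction hu using Subgroup.closure_induction_left with
  | one => exact ⟨0, by simp⟩
  | mul_left x hx y _ ih =>
    rcases hx with rfl | rfl
    · exact hi _ ih
    · exact hj _ ih
  | inv_mul_cancel x hx y _ ih =>
    rw [hij x hx]
    rcases hx with rfl | rfl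
    · exact hi _ ih
    · exact hj _ ih

/-- A finite rank two parabolic subgroup acts faithfully on every weight lattice. -/
theorem Realization.eq_one_of_weylHom_eq_one {i j : I} (h : i ≠ j)
    (hm : C.coxeterMatrix i j ≠ 0) {u : C.Weyl} (hu : u ∈ C.dihedral i j)
    (h1 : D.weylHom u = 1) : u = 1 := by
  obtain ⟨k, rfl | rfl⟩ := exists_of_mem_dihedral hu
  · have hord : orderOf (D.weylHom (C.cs.simple i * C.cs.simple j)) = C.coxeterMatrix i j := by
      rw [map_mul, weylHom_simple, weylHom_simple, orderOf_eq_iff (Nat.pos_of_ne_zero hm)]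
      exact ⟨D.reflectEquiv_isLiftable i j, fun d hd h0 => D.weylHom_mul_pow_ne_one h hm h0 hd⟩
    rw [map_zpow, ← orderOf_dvd_iff_zpow_eq_one, hord] at h1
    obtain ⟨q, rfl⟩ := h1
    rw [zpow_mul, zpow_natCast]
    have := C.cs.simple_mul_simple_pow i j
    change _ ^ C.coxeterMatrix i j = 1 at this
    rw [this, one_zpow]
  · exfalso
    -- According to the parity of `k` the element is conjugate to `s_i` or to `s_j`, neither of
    -- which acts trivially.
    rcases Int.even_or_odd' k with ⟨l, rfl | rfl⟩
    · have e : (C.cs.simple i * C.cs.simple j) ^ (2 * l) * C.cs.simple i =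
          (C.cs.simple i * C.cs.simple j) ^ l * C.cs.simple i *
            ((C.cs.simple i * C.cs.simple j) ^ l)⁻¹ := by
        rw [two_mul, zpow_add, mul_assoc, ← zpow_neg, mul_assoc, simple_mul_zpow, neg_neg]
      rw [e, map_mul, map_mul, map_inv, mul_inv_eq_one, mul_eq_left, weylHom_simple] at h1
      exact D.reflectEquiv_ne_one i h1
    · have e : (C.cs.simple i * C.cs.simple j) ^ (2 * l + 1) * C.cs.simple i =
          ((C.cs.simple i * C.cs.simple j) ^ l * C.cs.simple i) * C.cs.simple j *
            ((C.cs.simple i * C.cs.simple j) ^ l * C.cs.simple i)⁻¹ := by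
        rw [mul_inv_rev, ← zpow_neg, inv_simple, simple_mul_zpow, neg_neg, two_mul, zpow_add,
          zpow_add, zpow_one]
        have : C.cs.simple i * C.cs.simple j * (C.cs.simple i * C.cs.simple j) ^ l =
          (C.cs.simple i * C.cs.simple j) ^ l * (C.cs.simple i * C.cs.simple j) := by
          rw [← zpow_one_add, ← zpow_add_one, add_comm]
        rw [mul_assoc _ _ (C.cs.simple i * C.cs.simple j), ← this]
        simp only [mul_assoc]
      rw [e, map_mul, map_mul, map_inv, mul_inv_eq_one, mul_eq_left, weylHom_simple] at h1
      exact D.reflectEquiv_ne_one j h1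

end Reflections

end AffineNilHecke

end

noncomputable section

namespace AffineNilHecke

open CoxeterSystem

/-! ### Commuting weights past braid words -/

section Alternating

variable {I : Type*} {C : CartanDatum I} {P : Type*} [AddCommGroup P] (D : Realization C P)
variable {R : Type*} [Ring R] {A : I → R} {Λ : P → R}

/-- The pairing of the first letter of an alternating word of length `n + 2` with the image of `l`
under the other letters. -/
def Realization.headPairing (i j : I) : ℕ → P → ℤ
  | 0, l => D.coroot i (D.reflect j l)
  | n + 1, l => Realization.headPairing j i n (D.reflect j l)

theorem wordProduct_alternatingWord_succ (i j : I) (n : ℕ) :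
    wordProduct A (alternatingWord i j (n + 1)) = wordProduct A (alternatingWord j i n) * A j := by
  rw [alternatingWord_succ, List.concat_eq_append, wordProduct_append, wordProduct_cons,
    wordProduct_nil, mul_one]

theorem Realization.weylHom_alternatingWord_succ (i j : I) (n : ℕ) (l : P) :
    D.weylHom (C.cs.wordProd (alternatingWord i j (n + 1))) l =
      D.weylHom (C.cs.wordProd (alternatingWord j i n)) (D.reflect j l) := by
  rw [alternatingWord_succ, wordProd_concat, map_mul, weylHom_simple, LinearEquiv.mul_apply]
  rfl

/-- Moving a weight through the word can drop one letter. Dropping an inner letter makes two equal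
letters adjacent, which gives zero, so only the terms without the last or without the first letter
survive. -/
theorem wordProduct_alternatingWord_mul (hsq : ∀ i, A i * A i = 0)
    (hcomm : ∀ i l, A i * Λ l = Λ (D.reflect i l) * A i + (D.coroot i l : R))
    (i j : I) (n : ℕ) (l : P) :
    wordProduct A (alternatingWord i j (n + 2)) * Λ l =
      Λ (D.weylHom (C.cs.wordProd (alternatingWord i j (n + 2))) l) *
          wordProduct A (alternatingWord i j (n + 2)) +
        D.coroot j l • wordProduct A (alternatingWord j i (n + 1)) +
        D.headPairing i j n l • wordProduct A (alternatingWord i j (n + 1)) := by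
  induction n generalizing i j l with
  | zero =>
    simp only [wordProduct_alternatingWord_succ, D.weylHom_alternatingWord_succ]
    simp only [alternatingWord, wordProduct_nil, wordProd_nil, map_one, one_mul,
      LinearEquiv.coe_one, id, mul_assoc, hcomm, mul_add, Realization.headPairing]
    simp only [← mul_assoc, hcomm, add_mul, zsmul_eq_mul]
    rw [Int.cast_comm, Int.cast_comm]
    abel
  | succ n ih =>
    rw [wordProduct_alternatingWord_succ i j (n + 2), mul_assoc, hcomm, mul_add, ← mul_assoc, ih,
      wordProduct_alternatingWord_succ i j n, D.weylHom_alternatingWord_succ i j (n + 2),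
      Realization.headPairing, wordProduct_alternatingWord_succ i j (n + 1)]
    simp only [add_mul, smul_mul_assoc, mul_assoc, hsq, mul_zero, smul_zero, add_zero]
    simp only [zsmul_eq_mul]
    rw [(Int.cast_commute (D.coroot j l) _).eq]
    abel

/-- The difference of the two sides of a braid relation commutes with weights up to the action of
the longest element. -/
theorem braid_sub_mul (hsq : ∀ i, A i * A i = 0)
    (hcomm : ∀ i l, A i * Λ l = Λ (D.reflect i l) * A i + (D.coroot i l : R))
    {i j : I} (h : i ≠ j) (hm : C.coxeterMatrix i j ≠ 0) (l : P) :
    (wordProduct A (alternatingWord i j (C.coxeterMatrix i j)) -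
        wordProduct A (alternatingWord j i (C.coxeterMatrix i j))) * Λ l =
      Λ (D.weylHom (C.cs.wordProd (alternatingWord i j (C.coxeterMatrix i j))) l) *
        (wordProduct A (alternatingWord i j (C.coxeterMatrix i j)) -
          wordProduct A (alternatingWord j i (C.coxeterMatrix i j))) := by
  have hw : C.cs.wordProd (alternatingWord j i (C.coxeterMatrix i j)) =
      C.cs.wordProd (alternatingWord i j (C.coxeterMatrix i j)) := by
    have := C.cs.wordProd_braidWord_eq j i
    rw [braidWord, braidWord, C.coxeterMatrix.symmetric j i] at this
    exact this
  -- In every finite case the head pairing is the pairing with the coroot of the first letter. The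
  -- two shortened terms of one braid word are then those of the other in reverse order, and they
  -- cancel in the difference.
  obtain ⟨n, hn, h1, h2⟩ : ∃ n, C.coxeterMatrix i j = n + 2 ∧
      D.headPairing i j n l = D.coroot i l ∧ D.headPairing j i n l = D.coroot j l := by
    rcases C.finite_order_cases h hm with h | h | h | h | h | h <;> obtain ⟨h1, h2, h3⟩ := h
    · refine ⟨0, h1, ?_⟩
      simp [Realization.headPairing, D.coroot_reflect, h2, h3]
    · refine ⟨1, h1, ?_⟩
      simp only [Realization.headPairing, D.coroot_reflect, C.diag, h2, h3]
      constructor <;> ring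
    · refine ⟨2, h1, ?_⟩
      simp only [Realization.headPairing, D.coroot_reflect, C.diag, h2, h3]
      constructor <;> ring
    · refine ⟨2, h1, ?_⟩
      simp only [Realization.headPairing, D.coroot_reflect, C.diag, h2, h3]
      constructor <;> ring
    · refine ⟨4, h1, ?_⟩
      simp only [Realization.headPairing, D.coroot_reflect, C.diag, h2, h3]
      constructor <;> ring
    · refine ⟨4, h1, ?_⟩
      simp only [Realization.headPairing, D.coroot_reflect, C.diag, h2, h3]
      constructor <;> ring
  rw [hn] at hw ⊢
  rw [sub_mul, wordProduct_alternatingWord_mul D hsq hcomm, h1,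
    wordProduct_alternatingWord_mul D hsq hcomm, h2, hw, mul_sub]
  abel

end Alternating

/-! ### `Sym(P)`, its fraction field and the Weyl group action -/

section Coefficients

variable {I : Type*} {C : CartanDatum I} {P : Type*} [AddCommGroup P]

/-- Functoriality of the symmetric algebra for automorphisms. -/
def symEquivHom (P : Type*) [AddCommGroup P] :
    (P ≃ₗ[ℤ] P) →* (SymmetricAlgebra ℤ P ≃+* SymmetricAlgebra ℤ P) where
  toFun f := (AlgEquiv.ofAlgHom
    (SymmetricAlgebra.lift (SymmetricAlgebra.ι ℤ P ∘ₗ f.toLinearMap))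
    (SymmetricAlgebra.lift (SymmetricAlgebra.ι ℤ P ∘ₗ f.symm.toLinearMap))
    (by apply SymmetricAlgebra.algHom_ext; ext l; simp)
    (by apply SymmetricAlgebra.algHom_ext; ext l; simp)).toRingEquiv
  map_one' := by
    ext s
    change SymmetricAlgebra.lift _ s = AlgHom.id ℤ _ s
    congr 1
    apply SymmetricAlgebra.algHom_ext; ext l; simp
  map_mul' f g := by
    ext s
    change SymmetricAlgebra.lift _ s = ((SymmetricAlgebra.lift _).comp (SymmetricAlgebra.lift _)) s
    congr 1
    apply SymmetricAlgebra.algHom_ext; ext l; simp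

theorem symEquivHom_ι (f : P ≃ₗ[ℤ] P) (l : P) :
    symEquivHom P f (SymmetricAlgebra.ι ℤ P l) = SymmetricAlgebra.ι ℤ P (f l) :=
  SymmetricAlgebra.lift_ι_apply _ _

variable (D : Realization C P)

/-- The Weyl group action on `Sym(P)`. -/
def Realization.symHom : C.Weyl →* (SymmetricAlgebra ℤ P ≃+* SymmetricAlgebra ℤ P) :=
  (symEquivHom P).comp D.weylHom

theorem Realization.symHom_ι (g : C.Weyl) (l : P) :
    D.symHom g (SymmetricAlgebra.ι ℤ P l) = SymmetricAlgebra.ι ℤ P (D.weylHom g l) :=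
  symEquivHom_ι _ _

theorem Realization.symHom_simple_ι (i : I) (l : P) :
    D.symHom (C.cs.simple i) (SymmetricAlgebra.ι ℤ P l) =
      SymmetricAlgebra.ι ℤ P (D.reflect i l) := by
  rw [symHom_ι, weylHom_simple]; rfl

theorem Realization.reflect_root (i : I) : D.reflect i (D.root i) = - D.root i := by
  rw [reflect, D.pairing, C.diag]; module

/-- The algebra map extending `α_i^∨` sends `α_i` to 2. -/
theorem rootS_ne_zero (i : I) : NilHecke.rootS D i ≠ 0 := by
  intro h
  have := congrArg (SymmetricAlgebra.lift (D.coroot i)) h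
  simp [NilHecke.rootS, D.pairing, C.diag] at this

theorem symHom_simple_rootS (i : I) :
    D.symHom (C.cs.simple i) (NilHecke.rootS D i) = - NilHecke.rootS D i := by
  rw [NilHecke.rootS, D.symHom_simple_ι, D.reflect_root, map_neg]

theorem symmetricAlgebra_ι_injective [Module.Free ℤ P] :
    Function.Injective (SymmetricAlgebra.ι ℤ P) := by
  rw [injective_iff_map_eq_zero]
  intro l h
  rw [← Module.forall_dual_apply_eq_zero_iff ℤ]
  intro φ
  have := congrArg (SymmetricAlgebra.lift φ) h
  simpa using this

variable [Module.Free ℤ P]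

/-- The field of fractions of `Sym(P)`. -/
def SymFrac (P : Type*) [AddCommGroup P] : Type _ := FractionRing (SymmetricAlgebra ℤ P)

instance SymFrac.instField : Field (SymFrac P) := inferInstanceAs (Field (FractionRing (SymmetricAlgebra ℤ P)))

instance : Algebra (SymmetricAlgebra ℤ P) (SymFrac P) :=
  inferInstanceAs (Algebra (SymmetricAlgebra ℤ P) (FractionRing (SymmetricAlgebra ℤ P)))

instance : IsFractionRing (SymmetricAlgebra ℤ P) (SymFrac P) :=
  inferInstanceAs (IsFractionRing (SymmetricAlgebra ℤ P) (FractionRing (SymmetricAlgebra ℤ P)))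

/-- The Weyl group action on the field of fractions of `Sym(P)`. -/
def Realization.fracHom : C.Weyl →* (SymFrac P ≃+* SymFrac P) :=
  (IsFractionRing.ringEquivOfRingEquivHom (SymmetricAlgebra ℤ P) (SymFrac P)).comp D.symHom

theorem Realization.fracHom_algebraMap (g : C.Weyl) (s : SymmetricAlgebra ℤ P) :
    D.fracHom g (algebraMap _ (SymFrac P) s) = algebraMap _ (SymFrac P) (D.symHom g s) := by
  simp [fracHom]

/-- A simple root as an element of the field of fractions. -/
def Realization.rootFrac (i : I) : SymFrac P := algebraMap _ _ (NilHecke.rootS D i)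

theorem Realization.rootFrac_ne_zero (i : I) : D.rootFrac i ≠ 0 := by
  rw [rootFrac, Ne, IsFractionRing.to_map_eq_zero_iff]
  exact rootS_ne_zero D i

theorem Realization.fracHom_rootFrac (i : I) :
    D.fracHom (C.cs.simple i) (D.rootFrac i) = - D.rootFrac i := by
  rw [rootFrac, fracHom_algebraMap, symHom_simple_rootS, map_neg]

theorem Realization.fracHom_rootFrac_inv (i : I) :
    D.fracHom (C.cs.simple i) (D.rootFrac i)⁻¹ = - (D.rootFrac i)⁻¹ := by
  rw [map_inv₀, fracHom_rootFrac, inv_neg]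

/-- A weight as an element of the field of fractions. -/
def weightFrac (l : P) : SymFrac P := algebraMap _ _ (SymmetricAlgebra.ι ℤ P l)

theorem weightFrac_injective : Function.Injective (weightFrac (P := P)) :=
  (IsFractionRing.injective _ _).comp symmetricAlgebra_ι_injective

theorem Realization.fracHom_weightFrac (g : C.Weyl) (l : P) :
    D.fracHom g (weightFrac l) = weightFrac (D.weylHom g l) := by
  rw [weightFrac, fracHom_algebraMap, symHom_ι]; rfl

theorem Realization.weightFrac_reflect (i : I) (l : P) :
    weightFrac (D.reflect i l) = weightFrac l - D.coroot i l * D.rootFrac i := by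
  simp [weightFrac, reflect, rootFrac, NilHecke.rootS]

end Coefficients

/-! ### Demazure operators on semilinear representations and their braid relations -/

section SemilinearRep

variable {I : Type*} {C : CartanDatum I} {P : Type*} [AddCommGroup P] [Module.Free ℤ P]

/-- A semilinear representation of the Weyl group over the field of fractions of `Sym(P)`. -/
structure SemilinearRep (D : Realization C P) (V : Type*) [AddCommGroup V]
    [Module (SymFrac P) V] where
  /-- the operators by which the group acts -/
  hom : C.Weyl →* Module.End ℤ V
  hom_smul : ∀ g (q : SymFrac P) v, hom g (q • v) = D.fracHom g q • hom g v

variable {D : Realization C P} {V : Type*} [AddCommGroup V] [Module (SymFrac P) V]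

/-- Multiplication by a scalar, as an additive operator. -/
def scalarEnd {K : Type*} (V : Type*) [AddCommGroup V] [Monoid K] [DistribMulAction K V]
    (q : K) : Module.End ℤ V :=
  (DistribSMul.toAddMonoidHom V q).toIntLinearMap

theorem scalarEnd_apply {K : Type*} [Monoid K] [DistribMulAction K V] (q : K) (v : V) :
    scalarEnd V q v = q • v := rfl

namespace SemilinearRep

variable (ρ : SemilinearRep D V)

/-- The operator `α_i⁻¹ (1 - s_i)`. -/
def demazure (i : I) : Module.End ℤ V :=
  scalarEnd V (D.rootFrac i)⁻¹ * (1 - ρ.hom (C.cs.simple i))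

theorem demazure_apply (i : I) (v : V) :
    ρ.demazure i v = (D.rootFrac i)⁻¹ • (v - ρ.hom (C.cs.simple i) v) := rfl

theorem hom_simple_hom_simple (i : I) (v : V) :
    ρ.hom (C.cs.simple i) (ρ.hom (C.cs.simple i) v) = v := by
  rw [← Module.End.mul_apply, ← map_mul, simple_mul_simple_self, map_one]; rfl

theorem demazure_mul_self (i : I) : ρ.demazure i * ρ.demazure i = 0 := by
  ext v
  rw [Module.End.mul_apply, demazure_apply, demazure_apply, hom_smul, map_sub,
    hom_simple_hom_simple, D.fracHom_rootFrac_inv]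
  simp only [neg_smul, smul_neg, smul_sub, LinearMap.zero_apply]
  abel

theorem demazure_smul (i : I) (q : SymFrac P) (v : V) :
    ρ.demazure i (q • v) = D.fracHom (C.cs.simple i) q • ρ.demazure i v +
      ((D.rootFrac i)⁻¹ * (q - D.fracHom (C.cs.simple i) q)) • v := by
  simp only [demazure_apply, hom_smul, smul_sub, smul_smul, mul_sub, sub_smul]
  rw [mul_comm (D.fracHom _ q)]
  abel

theorem demazure_mul_scalarEnd (i : I) (l : P) :
    ρ.demazure i * scalarEnd V (weightFrac l) =
      scalarEnd V (weightFrac (D.reflect i l)) * ρ.demazure i +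
        (D.coroot i l : Module.End ℤ V) := by
  ext v
  simp only [Module.End.mul_apply, LinearMap.add_apply, scalarEnd_apply, demazure_smul,
    D.fracHom_weightFrac, D.weylHom_simple, D.reflectEquiv_apply, D.weightFrac_reflect,
    Module.End.intCast_apply]
  rw [sub_sub_cancel, mul_comm _ (D.rootFrac i), inv_mul_cancel_left₀ (D.rootFrac_ne_zero i),
    Int.cast_smul_eq_zsmul]

end SemilinearRep

section PermRep

variable (D) (X : Type*) [MulAction C.Weyl X]

/-- The semilinear action of a group element on finitely supported functions. -/
def permAct (g : C.Weyl) : (X →₀ SymFrac P) →+ (X →₀ SymFrac P) :=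
  (Finsupp.mapDomain.addMonoidHom (g • ·)).comp
    (Finsupp.mapRange.addMonoidHom (D.fracHom g).toAddMonoidHom)

theorem permAct_single (g : C.Weyl) (x : X) (q : SymFrac P) :
    permAct D X g (Finsupp.single x q) = Finsupp.single (g • x) (D.fracHom g q) := by
  simp [permAct]

/-- The semilinear permutation representation on finitely supported functions. -/
def permRep : SemilinearRep D (X →₀ SymFrac P) where
  hom :=
    { toFun g := (permAct D X g).toIntLinearMap
      map_one' := by
        refine LinearMap.ext fun f => ?_
        change permAct D X 1 f = f
        induction f using Finsupp.induction_linear with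
        | zero => rw [map_zero]
        | add f f' h h' => rw [map_add, h, h']
        | single x r => simp [permAct_single]
      map_mul' g h := by
        refine LinearMap.ext fun f => ?_
        change permAct D X (g * h) f = permAct D X g (permAct D X h f)
        induction f using Finsupp.induction_linear with
        | zero => simp only [map_zero]
        | add f f' h h' => simp only [map_add, h, h']
        | single x r => simp [permAct_single, mul_smul] }
  hom_smul g q v := by
    induction v using Finsupp.induction_linear with
    | zero => simp only [smul_zero, map_zero]
    | add f f' h h' => rw [smul_add, map_add, h, h', map_add, smul_add]
    | single x r =>
      rw [Finsupp.smul_single]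
      change permAct D X g _ = _ • permAct D X g _
      rw [permAct_single, permAct_single, Finsupp.smul_single, smul_eq_mul, map_mul, smul_eq_mul]

theorem permRep_hom_single (g : C.Weyl) (x : X) (q : SymFrac P) :
    (permRep D X).hom g (Finsupp.single x q) = Finsupp.single (g • x) (D.fracHom g q) :=
  permAct_single D X g x q

theorem permRep_hom_apply (g : C.Weyl) (f : X →₀ SymFrac P) (x : X) :
    (permRep D X).hom g f x = D.fracHom g (f (g⁻¹ • x)) := by
  classical
  induction f using Finsupp.induction_linear with
  | zero => simp
  | add f f' h h' => rw [map_add, Finsupp.add_apply, h, h', Finsupp.add_apply, map_add]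
  | single y r =>
    rw [permRep_hom_single, Finsupp.single_apply, Finsupp.single_apply]
    by_cases h : g • y = x
    · rw [if_pos h, if_pos (by rw [← h, inv_smul_smul])]
    · rw [if_neg h, if_neg (by rintro rfl; simp at h), map_zero]

theorem demazure_permRep_apply (i : I) (f : X →₀ SymFrac P) (x : X) :
    (permRep D X).demazure i f x = (D.rootFrac i)⁻¹ *
      (f x - D.fracHom (C.cs.simple i) (f (C.cs.simple i • x))) := by
  rw [SemilinearRep.demazure_apply, Finsupp.smul_apply, Finsupp.sub_apply, permRep_hom_apply,
    inv_simple, smul_eq_mul]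

end PermRep

theorem wordProduct_apply_induction {A : I → Module.End ℤ V} {z : List I} {Q : V → Prop}
    (h : ∀ k ∈ z, ∀ v, Q v → Q (A k v)) {v : V} (hv : Q v) : Q (wordProduct A z v) := by
  induction z with
  | nil => simpa [wordProduct_nil] using hv
  | cons k z ih =>
    rw [wordProduct_cons, Module.End.mul_apply]
    exact h k (by simp) _ (ih fun k hk => h k (by simp [hk]))

theorem mem_alternatingWord {i j k : I} {m : ℕ} (h : k ∈ alternatingWord i j m) :
    k = i ∨ k = j := by
  induction m generalizing i j with
  | zero => simp [alternatingWord] at h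
  | succ m ih =>
    rw [alternatingWord_succ, List.concat_eq_append, List.mem_append, List.mem_singleton] at h
    rcases h with h | h
    · exact (ih h).symm
    · exact Or.inr h

/-- Viewing functions on `W` as elements of the skew group ring, right multiplication by a weight
scales the value at `g` by `g(l)`; it commutes with the Demazure operators, which act from the left.
-/
theorem demazure_word_rightMul {z : List I} {l : P} {f f' : C.Weyl →₀ SymFrac P}
    (h : ∀ g, f' g = f g * D.fracHom g (weightFrac l)) (g : C.Weyl) :
    wordProduct (permRep D C.Weyl).demazure z f' g =
      wordProduct (permRep D C.Weyl).demazure z f g * D.fracHom g (weightFrac l) := by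
  induction z generalizing g with
  | nil => simpa [wordProduct_nil] using h g
  | cons k z ih =>
    rw [wordProduct_cons, Module.End.mul_apply, Module.End.mul_apply, demazure_permRep_apply,
      demazure_permRep_apply, ih, ih, map_mul, ← RingAut.mul_apply, ← map_mul, smul_eq_mul,
      simple_mul_simple_cancel_left]
    ring

/-- The sum of the values is zero on the image of a nonempty product of Demazure operators. -/
theorem sum_demazure (i : I) (f : C.Weyl →₀ SymFrac P) :
    Finsupp.linearCombination (SymFrac P) (fun _ : C.Weyl => (1 : SymFrac P)) ((permRep D C.Weyl).demazure i f) =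
      (D.rootFrac i)⁻¹ * (Finsupp.linearCombination (SymFrac P) (fun _ : C.Weyl => (1 : SymFrac P)) f -
        D.fracHom (C.cs.simple i) (Finsupp.linearCombination (SymFrac P) (fun _ : C.Weyl => (1 : SymFrac P)) f)) := by
  rw [SemilinearRep.demazure_apply, map_smul, map_sub, smul_eq_mul]
  congr 2
  induction f using Finsupp.induction_linear with
  | zero => simp
  | add f f' h h' => simp only [map_add, h, h']
  | single x r => rw [permRep_hom_single]; simp

/-- Summing the values intertwines the Demazure operators with those on the field itself, and there
the first operator kills `1`. -/
theorem sum_word_demazure {i j : I} {m : ℕ} (hm : m ≠ 0) :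
    Finsupp.linearCombination (SymFrac P) (fun _ : C.Weyl => (1 : SymFrac P))
      (wordProduct (permRep D C.Weyl).demazure (alternatingWord i j m) (Finsupp.single 1 1)) =
        0 := by
  obtain ⟨m, rfl⟩ := Nat.exists_eq_succ_of_ne_zero hm
  rw [wordProduct_alternatingWord_succ, Module.End.mul_apply]
  refine wordProduct_apply_induction (Q := fun f =>
    Finsupp.linearCombination (SymFrac P) (fun _ : C.Weyl => (1 : SymFrac P)) f = 0) (fun k _ f hf => ?_) ?_
  · rw [sum_demazure, hf]; simp
  · rw [sum_demazure]; simp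

/-- Let `E` be the difference of the two sides. Its value at the delta function of `1` is supported
on the dihedral group. Applying `E` to a weight multiple of this delta function scales the value at
`g` by `g(l)`, while `braid_sub_mul` scales it by `w₀(l)`; hence `g` and `w₀` act alike wherever the
value is nonzero. By faithfulness of the dihedral group only `g = w₀` is left, and the single
remaining coefficient is the sum of all values, which is zero. -/
theorem demazure_braid_regular {i j : I} (h : i ≠ j) (hm : C.coxeterMatrix i j ≠ 0) :
    (wordProduct (permRep D C.Weyl).demazure (alternatingWord i j (C.coxeterMatrix i j)) -
      wordProduct (permRep D C.Weyl).demazure (alternatingWord j i (C.coxeterMatrix i j)))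
        (Finsupp.single 1 1) = 0 := by
  have hcomm := fun l => LinearMap.congr_fun (braid_sub_mul D
    (permRep D C.Weyl).demazure_mul_self (permRep D C.Weyl).demazure_mul_scalarEnd h hm l)
      (Finsupp.single 1 1)
  set w₀ := C.cs.wordProd (alternatingWord i j (C.coxeterMatrix i j)) with hw₀
  set E := wordProduct (permRep D C.Weyl).demazure (alternatingWord i j (C.coxeterMatrix i j)) -
      wordProduct (permRep D C.Weyl).demazure (alternatingWord j i (C.coxeterMatrix i j)) with hE
  have hdih : ∀ z : List I, (∀ k ∈ z, k = i ∨ k = j) → C.cs.wordProd z ∈ C.dihedral i j := by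
    intro z hz
    refine Subgroup.list_prod_mem _ ?_
    intro x hx
    obtain ⟨k, hk, rfl⟩ := List.mem_map.mp hx
    rcases hz k hk with rfl | rfl
    · exact simple_left_mem_dihedral _ _
    · exact simple_right_mem_dihedral _ _
  have hsupp : ∀ g, E (Finsupp.single 1 1) g ≠ 0 → g ∈ C.dihedral i j := by
    have aux : ∀ z : List I, (∀ k ∈ z, k = i ∨ k = j) → ∀ g,
        wordProduct (permRep D C.Weyl).demazure z (Finsupp.single 1 1) g ≠ 0 →
          g ∈ C.dihedral i j := by
      intro z hz
      refine wordProduct_apply_induction (Q := fun f : C.Weyl →₀ SymFrac P =>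
        ∀ g, f g ≠ 0 → g ∈ C.dihedral i j) (fun k hk f hf g hg => ?_) (fun g hg => ?_)
      · have hk' : C.cs.simple k ∈ C.dihedral i j := by
          have := hdih [k] (by simpa using hz k hk)
          rwa [wordProd_singleton] at this
        rw [demazure_permRep_apply] at hg
        by_contra hc
        have h1 : f g = 0 := not_not.mp fun h => hc (hf g h)
        have h2 : f (C.cs.simple k • g) = 0 :=
          not_not.mp fun h => hc ((Subgroup.mul_mem_cancel_left _ hk').mp (hf _ h))
        rw [h1, h2] at hg
        simp at hg
      · classical
        rw [Finsupp.single_apply] at hg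
        split_ifs at hg with h
        · exact h ▸ one_mem _
        · exact absurd rfl hg
    intro g hg
    by_contra hc
    have h1 := not_not.mp fun h =>
      hc (aux (alternatingWord i j (C.coxeterMatrix i j)) (fun _ => mem_alternatingWord) g h)
    have h2 := not_not.mp fun h =>
      hc (aux (alternatingWord j i (C.coxeterMatrix i j)) (fun _ h => (mem_alternatingWord h).symm)
        g h)
    rw [hE, LinearMap.sub_apply, Finsupp.sub_apply, h1, h2] at hg
    simp at hg
  have hright : ∀ (l : P) g, E (scalarEnd _ (weightFrac l) (Finsupp.single 1 1)) g =
      E (Finsupp.single 1 1) g * D.fracHom g (weightFrac l) := by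
    intro l g
    have h0 : ∀ g : C.Weyl, (scalarEnd _ (weightFrac l) (Finsupp.single 1 1) :
        C.Weyl →₀ SymFrac P) g =
        (Finsupp.single 1 1 : C.Weyl →₀ SymFrac P) g * D.fracHom g (weightFrac l) := by
      classical
      intro g
      rw [scalarEnd_apply, Finsupp.smul_apply, Finsupp.single_apply, smul_eq_mul]
      split_ifs with h
      · subst h; simp
      · simp
    rw [hE, LinearMap.sub_apply, LinearMap.sub_apply, Finsupp.sub_apply, Finsupp.sub_apply,
      demazure_word_rightMul h0, demazure_word_rightMul h0, sub_mul]
  have huniq : ∀ g, E (Finsupp.single 1 1) g ≠ 0 → g = w₀ := by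
    intro g hg
    have h1 : ∀ l, D.weylHom g l = D.weylHom w₀ l := by
      intro l
      have h2 := DFunLike.congr_fun (hcomm l) g
      rw [Module.End.mul_apply, hright, Module.End.mul_apply, scalarEnd_apply, Finsupp.smul_apply,
        smul_eq_mul, mul_comm, D.fracHom_weightFrac] at h2
      exact weightFrac_injective (mul_right_cancel₀ hg h2)
    have h3 : w₀⁻¹ * g = 1 := by
      refine D.eq_one_of_weylHom_eq_one h hm
        (mul_mem (inv_mem (hdih _ fun _ => mem_alternatingWord)) (hsupp g hg)) ?_
      rw [map_mul, map_inv, inv_mul_eq_one]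
      exact (LinearEquiv.ext h1).symm
    exact (inv_mul_eq_one.mp h3).symm
  have hsingle : E (Finsupp.single 1 1) = Finsupp.single w₀ (E (Finsupp.single 1 1) w₀) := by
    classical
    ext g
    rw [Finsupp.single_apply]
    split_ifs with h
    · rw [h]
    · exact not_not.mp fun h' => h (huniq g h').symm
  have hsum : Finsupp.linearCombination (SymFrac P) (fun _ : C.Weyl => (1 : SymFrac P)) (E (Finsupp.single 1 1)) = 0 := by
    rw [hE, LinearMap.sub_apply, map_sub, sum_word_demazure hm, sum_word_demazure hm, sub_zero]
  rw [hsingle, Finsupp.linearCombination_single, smul_eq_mul, mul_one] at hsum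
  rw [hsingle, hsum, Finsupp.single_zero]

namespace SemilinearRep

variable (ρ : SemilinearRep D V)

/-- The map `δ_g ↦ g v` is equivariant and sends `δ_1` to `v`, so identities verified on `δ_1` in
the regular representation hold in every semilinear representation. -/
theorem linearCombination_demazure (v : V) (i : I) (f : C.Weyl →₀ SymFrac P) :
    Finsupp.linearCombination (SymFrac P) (fun g => ρ.hom g v) ((permRep D C.Weyl).demazure i f) =
      ρ.demazure i (Finsupp.linearCombination (SymFrac P) (fun g => ρ.hom g v) f) := by
  rw [demazure_apply, demazure_apply, map_smul, map_sub]
  congr 2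
  induction f using Finsupp.induction_linear with
  | zero => simp
  | add f f' h h' => simp only [map_add, h, h']
  | single x r =>
    rw [permRep_hom_single, Finsupp.linearCombination_single, Finsupp.linearCombination_single,
      hom_smul, smul_eq_mul, map_mul, Module.End.mul_apply]

theorem linearCombination_word_demazure (v : V) (z : List I) (f : C.Weyl →₀ SymFrac P) :
    Finsupp.linearCombination (SymFrac P) (fun g => ρ.hom g v)
        (wordProduct (permRep D C.Weyl).demazure z f) =
      wordProduct ρ.demazure z
        (Finsupp.linearCombination (SymFrac P) (fun g => ρ.hom g v) f) := by
  induction z with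
  | nil => simp [wordProduct_nil]
  | cons k z ih =>
    rw [wordProduct_cons, wordProduct_cons, Module.End.mul_apply, linearCombination_demazure, ih,
      Module.End.mul_apply]

/-- Demazure operators on semilinear representations satisfy the braid relations. -/
theorem demazure_braid {i j : I} (h : i ≠ j) (hm : C.coxeterMatrix i j ≠ 0) :
    wordProduct ρ.demazure (alternatingWord i j (C.coxeterMatrix i j)) =
      wordProduct ρ.demazure (alternatingWord j i (C.coxeterMatrix i j)) := by
  ext v
  have h1 := congrArg (Finsupp.linearCombination (SymFrac P) (fun g => ρ.hom g v))
    (demazure_braid_regular (D := D) h hm)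
  rw [LinearMap.sub_apply, map_sub, map_zero, sub_eq_zero, linearCombination_word_demazure,
    linearCombination_word_demazure, Finsupp.linearCombination_single, one_smul, map_one] at h1
  exact h1

end SemilinearRep

end SemilinearRep

end AffineNilHecke

end

noncomputable section

namespace AffineNilHecke

open CoxeterSystem
open scoped TensorProduct

/-! ### Words in the nilCoxeter algebra -/

section NilCoxeterWords

variable {I : Type*} (C : CartanDatum I)

theorem NilCoxeter.gen_mul_self (i : I) : NilCoxeter.gen C i * NilCoxeter.gen C i = 0 :=
  (map_mul _ _ _).symm.trans ((RingQuot.mkRingHom_rel (NilCoxeterRel.sq i)).trans (map_zero _))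

theorem NilCoxeter.gen_braid (i j : I) (hij : i ≠ j) (hm : C.coxeterMatrix i j ≠ 0) :
    wordProduct (NilCoxeter.gen C) (alternatingWord i j (C.coxeterMatrix i j)) =
      wordProduct (NilCoxeter.gen C) (alternatingWord j i (C.coxeterMatrix i j)) := by
  have := RingQuot.mkRingHom_rel (NilCoxeterRel.braid (C := C) i j hij hm)
  rw [wordProduct_map, wordProduct_map] at this
  exact this

variable {C}

theorem CartanDatum.isReducedWord_redWord (w : C.Weyl) : C.IsReducedWord w (C.redWord w) :=
  (C.exists_isReducedWord w).choose_spec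

theorem NilCoxeter.word_eq_elt {z : List I} (hz : C.cs.IsReduced z) :
    NilCoxeter.word C z = NilCoxeter.elt C (C.cs.wordProd z) :=
  wordProduct_eq_of_isReduced C.hasExactOrders (NilCoxeter.gen_braid C) hz
    (C.isReducedWord_redWord _).1 (C.isReducedWord_redWord _).2.symm

theorem NilCoxeter.word_eq_zero {z : List I} (hz : ¬ C.cs.IsReduced z) :
    NilCoxeter.word C z = 0 :=
  wordProduct_eq_zero C.hasExactOrders (NilCoxeter.gen_braid C) (NilCoxeter.gen_mul_self C) hz

end NilCoxeterWords

variable {I : Type*} {C : CartanDatum I} {P : Type*} [AddCommGroup P] (D : Realization C P)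

/-! ### Divided differences and the spanning property of the `A_w` -/

section DividedDifference

theorem exists_divDiff (i : I) (s : SymmetricAlgebra ℤ P) :
    ∃ d, s - D.symHom (C.cs.simple i) s = NilHecke.rootS D i * d := by
  induction s using SymmetricAlgebra.induction with
  | algebraMap r => exact ⟨0, by simp⟩
  | ι l =>
    refine ⟨(D.coroot i l : ℤ), ?_⟩
    rw [D.symHom_simple_ι, Realization.reflect, map_sub, map_zsmul, NilHecke.rootS]
    simp [mul_comm]
  | mul a b ha hb =>
    obtain ⟨d, hd⟩ := ha
    obtain ⟨e, he⟩ := hb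
    exact ⟨d * b + D.symHom (C.cs.simple i) a * e, by
      rw [map_mul]; linear_combination b * hd + D.symHom (C.cs.simple i) a * he⟩
  | add a b ha hb =>
    obtain ⟨d, hd⟩ := ha
    obtain ⟨e, he⟩ := hb
    exact ⟨d + e, by rw [map_add]; linear_combination hd + he⟩

/-- The divided difference operator `s ↦ (s - s_i s) / α_i` on `Sym(P)`. -/
def divDiff (i : I) (s : SymmetricAlgebra ℤ P) : SymmetricAlgebra ℤ P :=
  (exists_divDiff D i s).choose

theorem rootS_mul_divDiff (i : I) (s : SymmetricAlgebra ℤ P) :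
    NilHecke.rootS D i * divDiff D i s = s - D.symHom (C.cs.simple i) s :=
  (exists_divDiff D i s).choose_spec.symm

variable [Module.Free ℤ P]

variable {D} in
theorem divDiff_eq {i : I} {s d : SymmetricAlgebra ℤ P}
    (h : NilHecke.rootS D i * d = s - D.symHom (C.cs.simple i) s) : divDiff D i s = d :=
  mul_left_cancel₀ (rootS_ne_zero D i) ((rootS_mul_divDiff D i s).trans h.symm)

theorem divDiff_ι (i : I) (l : P) :
    divDiff D i (SymmetricAlgebra.ι ℤ P l) = (D.coroot i l : ℤ) := by
  apply divDiff_eq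
  rw [D.symHom_simple_ι, Realization.reflect, map_sub, map_zsmul, NilHecke.rootS]
  simp [mul_comm]

theorem divDiff_intCast (i : I) (n : ℤ) : divDiff D i (n : SymmetricAlgebra ℤ P) = 0 := by
  apply divDiff_eq; simp

theorem divDiff_one (i : I) : divDiff D i 1 = 0 := by
  apply divDiff_eq; simp

theorem divDiff_add (i : I) (a b : SymmetricAlgebra ℤ P) :
    divDiff D i (a + b) = divDiff D i a + divDiff D i b := by
  apply divDiff_eq
  rw [mul_add, rootS_mul_divDiff, rootS_mul_divDiff, map_add]; ring

theorem divDiff_zero (i : I) : divDiff D i 0 = 0 := by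
  apply divDiff_eq; simp

theorem divDiff_mul (i : I) (a b : SymmetricAlgebra ℤ P) :
    divDiff D i (a * b) =
      divDiff D i a * b + D.symHom (C.cs.simple i) a * divDiff D i b := by
  apply divDiff_eq
  rw [map_mul]
  linear_combination b * rootS_mul_divDiff D i a +
    D.symHom (C.cs.simple i) a * rootS_mul_divDiff D i b

theorem algebraMap_divDiff (i : I) (s : SymmetricAlgebra ℤ P) :
    algebraMap _ (SymFrac P) (divDiff D i s) = (D.rootFrac i)⁻¹ *
      (algebraMap _ (SymFrac P) s -
        D.fracHom (C.cs.simple i) (algebraMap _ (SymFrac P) s)) := by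
  rw [D.fracHom_algebraMap, ← map_sub, ← rootS_mul_divDiff, map_mul]
  exact (inv_mul_cancel_left₀ (D.rootFrac_ne_zero i) _).symm

theorem NilHecke.gen_mul_scalar_eq (i : I) (s : SymmetricAlgebra ℤ P) :
    gen D i * scalar D s = scalar D (D.symHom (C.cs.simple i) s) * gen D i +
      scalar D (divDiff D i s) := by
  induction s using SymmetricAlgebra.induction with
  | algebraMap r =>
    rw [eq_intCast, divDiff_intCast, map_intCast, map_intCast, map_intCast, map_zero, add_zero]
    exact (Int.cast_commute _ _).symm.eq
  | ι l => rw [gen_mul_scalar, D.symHom_simple_ι, divDiff_ι, map_intCast]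
  | mul a b ha hb =>
    rw [map_mul, ← mul_assoc, ha, add_mul, mul_assoc, hb, divDiff_mul]
    simp only [map_mul, map_add, mul_add, mul_assoc]
    abel
  | add a b ha hb =>
    rw [map_add, mul_add, ha, hb, divDiff_add]
    simp only [map_add, add_mul]
    abel

end DividedDifference

namespace NilHecke

theorem gen_mul_self (i : I) : gen D i * gen D i = 0 :=
  (map_mul _ _ _).symm.trans ((mk_rel D (.sq i)).trans (map_zero _))

theorem gen_braid (i j : I) (hij : i ≠ j) (hm : C.coxeterMatrix i j ≠ 0) :
    wordProduct (gen D) (alternatingWord i j (C.coxeterMatrix i j)) =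
      wordProduct (gen D) (alternatingWord j i (C.coxeterMatrix i j)) := by
  have := mk_rel D (.braid i j hij hm)
  rw [wordProduct_map, wordProduct_map] at this
  exact this

theorem word_eq_elt {z : List I} (hz : C.cs.IsReduced z) :
    wordProduct (gen D) z = elt D (C.cs.wordProd z) :=
  wordProduct_eq_of_isReduced C.hasExactOrders (gen_braid D) hz
    (C.isReducedWord_redWord _).1 (C.isReducedWord_redWord _).2.symm

theorem word_eq_zero {z : List I} (hz : ¬ C.cs.IsReduced z) : wordProduct (gen D) z = 0 :=
  wordProduct_eq_zero C.hasExactOrders (gen_braid D) (gen_mul_self D) hz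

theorem elt_one : elt D (1 : C.Weyl) = 1 := by
  have h := word_eq_elt D (z := []) (by simp [CoxeterSystem.IsReduced])
  rw [wordProd_nil] at h
  rw [← h, wordProduct_nil]

variable [Module.Free ℤ P]

/-- The span contains `1` and is stable under left multiplication by all generators: `A_i A_w` is a
basis element or zero, and scalars move to the left through `A_i`. -/
theorem span_elt : Submodule.span (SymmetricAlgebra ℤ P) (Set.range (elt D)) = ⊤ := by
  set N := Submodule.span (SymmetricAlgebra ℤ P) (Set.range (elt D)) with hN
  have hgen : ∀ i, ∀ n ∈ N, gen D i * n ∈ N := by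
    intro i n hn
    induction hn using Submodule.span_induction with
    | mem x hx =>
      obtain ⟨w, rfl⟩ := hx
      rw [elt, ← wordProduct_cons]
      by_cases h : C.cs.IsReduced (i :: C.redWord w)
      · rw [word_eq_elt D h]; exact Submodule.subset_span ⟨_, rfl⟩
      · rw [word_eq_zero D h]; exact zero_mem _
    | zero => rw [mul_zero]; exact zero_mem _
    | add x y _ _ hx hy => rw [mul_add]; exact add_mem hx hy
    | smul s x hx' hx =>
      rw [smul_def, ← mul_assoc, gen_mul_scalar_eq, add_mul, mul_assoc, ← smul_def, ← smul_def]
      exact add_mem (N.smul_mem _ hx) (N.smul_mem _ hx')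
  have hmul : ∀ p : FreeAlgebra ℤ (SymmetricAlgebra ℤ P ⊕ I), ∀ n ∈ N, mk D p * n ∈ N := by
    intro p
    induction p using FreeAlgebra.induction with
    | grade0 r =>
      intro n hn
      rw [eq_intCast, map_intCast, ← zsmul_eq_mul]
      exact zsmul_mem hn _
    | grade1 x =>
      intro n hn
      rcases x with s | i
      · exact N.smul_mem s hn
      · exact hgen i n hn
    | mul a b ha hb => intro n hn; rw [map_mul, mul_assoc]; exact ha _ (hb _ hn)
    | add a b ha hb => intro n hn; rw [map_add, add_mul]; exact add_mem (ha _ hn) (hb _ hn)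
  rw [eq_top_iff]
  rintro a -
  obtain ⟨p, rfl⟩ := mk_surjective D a
  have := hmul p 1 (elt_one D ▸ Submodule.subset_span ⟨1, rfl⟩)
  rwa [mul_one] at this

end NilHecke

/-! ### The nilHecke algebra acting on semilinear representations -/

section Representation

variable {D} [Module.Free ℤ P] {V : Type*} [AddCommGroup V] [Module (SymFrac P) V]

namespace SemilinearRep

variable (ρ : SemilinearRep D V)

/-- The operators of noncommutative polynomials in the generators of the nilHecke algebra. -/
def freeHom : FreeAlgebra ℤ (SymmetricAlgebra ℤ P ⊕ I) →ₐ[ℤ] Module.End ℤ V :=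
  FreeAlgebra.lift ℤ (Sum.elim (fun s => scalarEnd V (algebraMap _ (SymFrac P) s)) ρ.demazure)

theorem freeHom_inl (s : SymmetricAlgebra ℤ P) :
    ρ.freeHom (FreeAlgebra.ι ℤ (Sum.inl s)) = scalarEnd V (algebraMap _ (SymFrac P) s) := by
  simp [freeHom]

theorem freeHom_inr (i : I) : ρ.freeHom (FreeAlgebra.ι ℤ (Sum.inr i)) = ρ.demazure i := by
  simp [freeHom]

theorem freeHom_rel {x y : FreeAlgebra ℤ (SymmetricAlgebra ℤ P ⊕ I)} (h : NilHeckeRel D x y) :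
    ρ.freeHom x = ρ.freeHom y := by
  induction h with
  | one => ext v; simp [freeHom_inl, scalarEnd_apply]
  | add s t =>
    ext v; simp [freeHom_inl, scalarEnd_apply, add_smul]
  | mul s t => ext v; simp [freeHom_inl, scalarEnd_apply, mul_smul]
  | sq i => rw [map_mul, freeHom_inr, map_zero, demazure_mul_self]
  | braid i j hij hm =>
    rw [wordProduct_map, wordProduct_map]
    simp only [freeHom_inr]
    exact ρ.demazure_braid hij hm
  | comm i l =>
    rw [map_mul, map_add, map_mul, AlgHom.commutes, freeHom_inr, freeHom_inl, freeHom_inl]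
    exact ρ.demazure_mul_scalarEnd i l

/-- The nilHecke algebra acts on semilinear representations of the Weyl group. -/
def nilHeckeHom : NilHecke D →+* Module.End ℤ V :=
  RingQuot.lift ⟨ρ.freeHom.toRingHom, fun _ _ h => ρ.freeHom_rel h⟩

theorem nilHeckeHom_mk (p : FreeAlgebra ℤ (SymmetricAlgebra ℤ P ⊕ I)) :
    ρ.nilHeckeHom (NilHecke.mk D p) = ρ.freeHom p :=
  RingQuot.lift_mkRingHom_apply _ _ _

theorem nilHeckeHom_gen (i : I) : ρ.nilHeckeHom (NilHecke.gen D i) = ρ.demazure i :=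
  (ρ.nilHeckeHom_mk _).trans (ρ.freeHom_inr i)

theorem nilHeckeHom_scalar (s : SymmetricAlgebra ℤ P) :
    ρ.nilHeckeHom (NilHecke.scalar D s) = scalarEnd V (algebraMap _ (SymFrac P) s) :=
  (ρ.nilHeckeHom_mk _).trans (ρ.freeHom_inl s)

end SemilinearRep

end Representation

/-! ### Independence of the `A_x ⊗ A_y` and well-definedness of the coproduct -/

section Regular

variable [Module.Free ℤ P]

/-- The orbit map of the identity in the regular representation. -/
def NilHecke.toRegular : NilHecke D →ₗ[SymmetricAlgebra ℤ P] (C.Weyl →₀ SymFrac P) where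
  toFun a := (permRep D C.Weyl).nilHeckeHom a (Finsupp.single 1 1)
  map_add' a b := by rw [map_add, LinearMap.add_apply]
  map_smul' s a := by
    rw [smul_def, map_mul, Module.End.mul_apply, SemilinearRep.nilHeckeHom_scalar, scalarEnd_apply,
      algebraMap_smul, RingHom.id_apply]

theorem NilHecke.toRegular_gen_mul (i : I) (a : NilHecke D) :
    toRegular D (gen D i * a) = (permRep D C.Weyl).demazure i (toRegular D a) := by
  change (permRep D C.Weyl).nilHeckeHom (gen D i * a) _ = _
  rw [map_mul, SemilinearRep.nilHeckeHom_gen]; rfl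

theorem NilHecke.toRegular_one : toRegular D 1 = Finsupp.single 1 1 := by
  change (permRep D C.Weyl).nilHeckeHom 1 _ = _
  rw [map_one]; rfl

/-- Triangularity: `∂_i f` at `g` involves only `f(g)` and `f(s_i g)`, so apart from the product of
the word only elements shorter than the word occur. -/
theorem NilHecke.toRegular_word_apply_ne_zero {z : List I} {g : C.Weyl}
    (h : toRegular D (wordProduct (gen D) z) g ≠ 0) :
    g = C.cs.wordProd z ∨ C.cs.length g < z.length := by
  classical
  induction z generalizing g with
  | nil =>
    rw [wordProduct_nil, toRegular_one, Finsupp.single_apply] at h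
    left
    split_ifs at h with h1
    · rw [← h1, wordProd_nil]
    · exact absurd rfl h
  | cons i z ih =>
    rw [wordProduct_cons, toRegular_gen_mul, demazure_permRep_apply] at h
    by_cases h1 : toRegular D (wordProduct (gen D) z) g = 0
    · have h2 : toRegular D (wordProduct (gen D) z) (C.cs.simple i • g) ≠ 0 := by
        intro h2; rw [h1, h2] at h; simp at h
      rcases ih h2 with h3 | h3
      · left
        rw [wordProd_cons, ← h3, smul_eq_mul, simple_mul_simple_cancel_left]
      · right
        rw [smul_eq_mul] at h3
        have := C.cs.length_simple_mul g i
        simp only [List.length_cons]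
        omega
    · right
      rcases ih h1 with h3 | h3
      · rw [h3]; exact Nat.lt_succ_of_le (C.cs.length_wordProd_le z)
      · simp only [List.length_cons]; omega

theorem NilHecke.toRegular_word_apply_wordProd {z : List I} (hz : C.cs.IsReduced z) :
    toRegular D (wordProduct (gen D) z) (C.cs.wordProd z) ≠ 0 := by
  induction z with
  | nil => rw [wordProduct_nil, toRegular_one, wordProd_nil]; simp
  | cons i z ih =>
    have hz' : C.cs.IsReduced z := by simpa using hz.drop 1
    rw [wordProduct_cons, toRegular_gen_mul, demazure_permRep_apply]
    -- For length reasons the tail `z` contributes nothing at the longer element, so the leading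
    -- coefficient comes from the reflected term alone.
    have h1 : toRegular D (wordProduct (gen D) z) (C.cs.wordProd (i :: z)) = 0 := by
      by_contra h
      have hl := hz.eq
      rcases toRegular_word_apply_ne_zero D h with h2 | h2
      · rw [h2, hz'.eq] at hl; simp at hl
      · rw [hl] at h2; simp at h2
    rw [h1, wordProd_cons, smul_eq_mul, simple_mul_simple_cancel_left, zero_sub, mul_neg, neg_ne_zero]
    exact mul_ne_zero (inv_ne_zero (D.rootFrac_ne_zero i))
      ((map_ne_zero_iff _ (D.fracHom _).injective).mpr (ih hz'))

theorem NilHecke.linearIndependent_toRegular_elt :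
    LinearIndependent (SymFrac P) (fun w : C.Weyl => toRegular D (elt D w)) := by
  rw [linearIndependent_iff]
  intro f hf
  by_contra hne
  -- At an element `w` of maximal length in the support, triangularity removes every other summand.
  obtain ⟨w, hw, hmax⟩ := f.support.exists_max_image C.cs.length (Finsupp.support_nonempty_iff.mpr hne)
  have h := DFunLike.congr_fun hf w
  rw [Finsupp.linearCombination_apply, Finsupp.sum, Finsupp.finsetSum_apply,
    Finset.sum_eq_single_of_mem w hw, Finsupp.smul_apply, Finsupp.coe_zero, Pi.zero_apply,
    smul_eq_zero] at h
  · rcases h with h | h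
    · exact Finsupp.mem_support_iff.mp hw h
    · have := toRegular_word_apply_wordProd D (C.isReducedWord_redWord w).1
      rw [(C.isReducedWord_redWord w).2] at this
      exact this h
  · intro w' hw' hne'
    rw [Finsupp.smul_apply, smul_eq_zero]
    right
    by_contra h
    rcases toRegular_word_apply_ne_zero D h with h2 | h2
    · rw [(C.isReducedWord_redWord w').2] at h2; exact hne' h2.symm
    · rw [← (C.isReducedWord_redWord w').1.eq, (C.isReducedWord_redWord w').2] at h2
      exact absurd (hmax w' hw') (not_le_of_gt h2)

/-- The map from the tensor square to functions on `W × W` induced by the orbit map. -/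
def NilHecke.tensorToRegular :
    TensorSquare D →ₗ[SymmetricAlgebra ℤ P] (C.Weyl × C.Weyl →₀ SymFrac P) :=
  TensorProduct.lift (LinearMap.mk₂ _
    (fun m n => finsuppTensorFinsupp' (SymFrac P) C.Weyl C.Weyl
      (toRegular D m ⊗ₜ[SymFrac P] toRegular D n))
    (fun m m' n => by rw [map_add, TensorProduct.add_tmul, map_add])
    (fun s m n => by
      rw [map_smul, ← algebraMap_smul (SymFrac P) s (toRegular D m), ← TensorProduct.smul_tmul',
        map_smul, algebraMap_smul])
    (fun m n n' => by rw [map_add, TensorProduct.tmul_add, map_add])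
    (fun s m n => by
      rw [map_smul, ← algebraMap_smul (SymFrac P) s (toRegular D n), TensorProduct.tmul_smul,
        map_smul, algebraMap_smul]))

theorem NilHecke.tensorToRegular_tmul (m n : NilHecke D) :
    tensorToRegular D (m ⊗ₜ n) = finsuppTensorFinsupp' (SymFrac P) C.Weyl C.Weyl
      (toRegular D m ⊗ₜ[SymFrac P] toRegular D n) := rfl

theorem NilHecke.tensorToRegular_tmul_apply (m n : NilHecke D) (a b : C.Weyl) :
    tensorToRegular D (m ⊗ₜ n) (a, b) = toRegular D m a * toRegular D n b := by
  rw [tensorToRegular_tmul, finsuppTensorFinsupp'_apply_apply]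

theorem linearIndependent_of_apply_eq_mul {R K X ι : Type*} [CommRing R] [Field K] [Algebra R K]
    [FaithfulSMul R K] {f : ι → X →₀ K} (hf : LinearIndependent K f)
    {F : ι × ι → (X × X →₀ K)} (hF : ∀ p a b, F p (a, b) = f p.1 a * f p.2 b) :
    LinearIndependent R F := by
  have h : LinearIndependent K fun p : ι × ι => f p.1 ⊗ₜ[K] f p.2 := hf.tmul_of_flat_left hf
  have h2 : LinearIndependent K F := by
    convert h.map_injOn (finsuppTensorFinsupp' K X X).toLinearMap (LinearEquiv.injective _).injOn
    ext p ⟨a, b⟩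
    simp [hF, finsuppTensorFinsupp'_apply_apply]
  refine h2.restrict_scalars fun s t hst => ?_
  simp only [Algebra.smul_def, mul_one] at hst
  exact FaithfulSMul.algebraMap_injective _ _ hst

theorem NilHecke.linearIndependent_tensorToRegular :
    LinearIndependent (SymmetricAlgebra ℤ P)
      (fun p : C.Weyl × C.Weyl => tensorToRegular D (elt D p.1 ⊗ₜ elt D p.2)) :=
  have : FaithfulSMul (SymmetricAlgebra ℤ P) (SymFrac P) :=
    (faithfulSMul_iff_algebraMap_injective _ _).mpr (IsFractionRing.injective _ _)
  linearIndependent_of_apply_eq_mul (linearIndependent_toRegular_elt D)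
    fun _ _ _ => tensorToRegular_tmul_apply D _ _ _ _

theorem NilHecke.linearIndependent_elt_tmul_elt :
    LinearIndependent (SymmetricAlgebra ℤ P)
      (fun p : C.Weyl × C.Weyl => elt D p.1 ⊗ₜ[SymmetricAlgebra ℤ P] elt D p.2) :=
  LinearIndependent.of_comp (tensorToRegular D) (linearIndependent_tensorToRegular D)

theorem NilHecke.linearCombination_surjective :
    Function.Surjective (Finsupp.linearCombination (SymmetricAlgebra ℤ P)
      (fun p : C.Weyl × C.Weyl => elt D p.1 ⊗ₜ[SymmetricAlgebra ℤ P] elt D p.2)) := by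
  rw [← LinearMap.range_eq_top, Finsupp.range_linearCombination,
    ← TensorProduct.map₂_mk_top_top_eq_top, ← span_elt, Submodule.map₂_span_span,
    Set.image2_range]
  rfl

/-- A spanning family is sent to an independent one. Identities in the tensor square can therefore
be verified among functions on `W × W`. -/
theorem NilHecke.tensorToRegular_injective : Function.Injective (tensorToRegular D) := by
  rw [injective_iff_map_eq_zero]
  intro t ht
  obtain ⟨f, rfl⟩ := linearCombination_surjective D t
  rw [Finsupp.apply_linearCombination] at ht
  rw [linearIndependent_iff.mp (linearIndependent_tensorToRegular D) f ht, map_zero]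

/-- Substituting `s_i = 1 - α_i A_i` into `α_i⁻¹ (1 - s_i ⊗ s_i)` gives exactly the three terms of
`genAct`. -/
theorem NilHecke.tensorToRegular_genAct (i : I) (t : TensorSquare D) :
    tensorToRegular D (genAct D i t) =
      (permRep D (C.Weyl × C.Weyl)).demazure i (tensorToRegular D t) := by
  induction t using TensorProduct.induction_on with
  | zero => simp only [map_zero]
  | add x y hx hy => simp only [map_add, hx, hy]
  | tmul m n =>
    ext ⟨a, b⟩
    rw [genAct_tmul, ← TensorProduct.smul_tmul', map_sub, map_add, map_smul, demazure_permRep_apply,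
      Finsupp.sub_apply, Finsupp.add_apply, Finsupp.smul_apply, Algebra.smul_def, Prod.smul_mk]
    simp only [tensorToRegular_tmul_apply, toRegular_gen_mul, demazure_permRep_apply, map_mul]
    have h := D.rootFrac_ne_zero i
    change _ + _ - D.rootFrac i * _ = _
    field_simp
    ring

theorem NilHecke.tensorToRegular_freeAct (p : FreeAlgebra ℤ (SymmetricAlgebra ℤ P ⊕ I))
    (t : TensorSquare D) :
    tensorToRegular D (freeAct D p t) =
      (permRep D (C.Weyl × C.Weyl)).freeHom p (tensorToRegular D t) := by
  induction p using FreeAlgebra.induction generalizing t with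
  | grade0 r => simp
  | grade1 x =>
    rcases x with s | i
    · rw [SemilinearRep.freeHom_inl, scalarEnd_apply, algebraMap_smul, ← map_smul, freeAct,
        FreeAlgebra.lift_ι_apply]
      rfl
    · rw [SemilinearRep.freeHom_inr, ← tensorToRegular_genAct, freeAct,
        FreeAlgebra.lift_ι_apply]
      rfl
  | mul a b ha hb => rw [map_mul, map_mul, Module.End.mul_apply, ha, hb, Module.End.mul_apply]
  | add a b ha hb =>
    rw [map_add, map_add, LinearMap.add_apply, map_add, ha, hb, LinearMap.add_apply]

/-- The preimage chosen in `act` is arbitrary. It does not matter, because on functions on `W × W`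
the free algebra acts through the nilHecke algebra. -/
theorem NilHecke.act_mk (p : FreeAlgebra ℤ (SymmetricAlgebra ℤ P ⊕ I)) :
    act D (mk D p) = freeAct D p := by
  ext t
  apply tensorToRegular_injective D
  rw [act, tensorToRegular_freeAct, tensorToRegular_freeAct, ← SemilinearRep.nilHeckeHom_mk,
    Function.surjInv_eq (mk_surjective D), SemilinearRep.nilHeckeHom_mk]

theorem NilHecke.act_mul (a b : NilHecke D) : act D (a * b) = act D a * act D b := by
  obtain ⟨p, rfl⟩ := mk_surjective D a
  obtain ⟨q, rfl⟩ := mk_surjective D b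
  rw [← map_mul, act_mk, act_mk, act_mk, map_mul]

theorem NilHecke.act_one : act D 1 = 1 := by
  rw [← map_one (mk D), act_mk, map_one]

theorem NilHecke.act_gen (i : I) (t : TensorSquare D) : act D (gen D i) t = genAct D i t := by
  rw [gen, act_mk, freeAct, FreeAlgebra.lift_ι_apply]; rfl

theorem NilHecke.genAct_smul (i : I) (s : SymmetricAlgebra ℤ P) (t : TensorSquare D) :
    genAct D i (s • t) =
      D.symHom (C.cs.simple i) s • genAct D i t + divDiff D i s • t := by
  apply tensorToRegular_injective D
  rw [tensorToRegular_genAct, (tensorToRegular D).map_smul, map_add, (tensorToRegular D).map_smul,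
    (tensorToRegular D).map_smul, tensorToRegular_genAct, ← algebraMap_smul (SymFrac P) s (tensorToRegular D t),
    ← algebraMap_smul (SymFrac P) (divDiff D i s) (tensorToRegular D t),
    ← algebraMap_smul (SymFrac P) (D.symHom _ s), SemilinearRep.demazure_smul, algebraMap_divDiff,
    D.fracHom_algebraMap]

theorem NilHecke.coproduct_gen_mul (i : I) (a : NilHecke D) :
    coproduct D (gen D i * a) = genAct D i (coproduct D a) := by
  rw [coproduct, act_mul, Module.End.mul_apply, act_gen]; rfl

theorem NilHecke.coproduct_one : coproduct D 1 = 1 ⊗ₜ 1 := by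
  rw [coproduct, act_one]; rfl

theorem NilHecke.coords_linearCombination (f : C.Weyl × C.Weyl →₀ SymmetricAlgebra ℤ P) :
    coords D (Finsupp.linearCombination (SymmetricAlgebra ℤ P)
      (fun p : C.Weyl × C.Weyl => elt D p.1 ⊗ₜ[SymmetricAlgebra ℤ P] elt D p.2) f) = f :=
  Function.leftInverse_invFun (linearIndependent_elt_tmul_elt D) f

theorem NilHecke.phiZeroTwo_add (t t' : TensorSquare D) :
    phiZeroTwo D (t + t') = phiZeroTwo D t + phiZeroTwo D t' := by
  classical
  obtain ⟨f, rfl⟩ := linearCombination_surjective D t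
  obtain ⟨f', rfl⟩ := linearCombination_surjective D t'
  rw [← map_add, phiZeroTwo, phiZeroTwo, phiZeroTwo, coords_linearCombination,
    coords_linearCombination, coords_linearCombination, Finsupp.sum_add_index']
  · simp
  · intro p s s'; rw [map_add, add_smul]

theorem NilHecke.phiZeroTwo_sum {ι : Type*} (S : Finset ι) (t : ι → TensorSquare D) :
    phiZeroTwo D (∑ k ∈ S, t k) = ∑ k ∈ S, phiZeroTwo D (t k) :=
  map_sum (AddMonoidHom.mk' (phiZeroTwo D) (phiZeroTwo_add D)) t S

/-- The words need not be reduced: nonreduced ones vanish in both algebras. Hence `φ₀⁽²⁾` applies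
termwise to the expansion over all embedded subwords. -/
theorem NilHecke.phiZeroTwo_smul_word (s : SymmetricAlgebra ℤ P) (z z' : List I) :
    phiZeroTwo D (s • (wordProduct (gen D) z ⊗ₜ wordProduct (gen D) z')) =
      evalZero P s • (NilCoxeter.word C z ⊗ₜ[ℤ] NilCoxeter.word C z') := by
  have h0 : phiZeroTwo D 0 = 0 := (AddMonoidHom.mk' (phiZeroTwo D) (phiZeroTwo_add D)).map_zero
  by_cases hz : C.cs.IsReduced z
  · by_cases hz' : C.cs.IsReduced z'
    · have := coords_linearCombination D
        (Finsupp.single (C.cs.wordProd z, C.cs.wordProd z') s)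
      rw [Finsupp.linearCombination_single] at this
      rw [word_eq_elt D hz, word_eq_elt D hz', phiZeroTwo, this, Finsupp.sum_single_index (by simp),
        NilCoxeter.word_eq_elt hz, NilCoxeter.word_eq_elt hz']
    · rw [word_eq_zero D hz', NilCoxeter.word_eq_zero hz', TensorProduct.tmul_zero, smul_zero, h0,
        TensorProduct.tmul_zero, smul_zero]
  · rw [word_eq_zero D hz, NilCoxeter.word_eq_zero hz, TensorProduct.zero_tmul, smul_zero, h0,
        TensorProduct.zero_tmul, smul_zero]

end Regular

end AffineNilHecke

end

noncomputable section

namespace AffineNilHecke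

open CoxeterSystem
open scoped TensorProduct

/-! ### Expansion of the coproduct along a word -/

section Subwords

variable {I : Type*} {v : List I}

theorem subwordAt_insert {t : Fin v.length} {p : Finset (Fin v.length)} (h : ∀ b ∈ p, t < b) :
    subwordAt v (insert t p) = v.get t :: subwordAt v p := by
  rw [subwordAt, Finset.sort_insert _ (fun b hb => (h b hb).le) (fun ht => lt_irrefl _ (h t ht))]
  rfl

theorem subwordAt_empty : subwordAt v ∅ = [] := by simp [subwordAt]

end Subwords

variable {I : Type*} {C : CartanDatum I} {P : Type*} [AddCommGroup P] (D : Realization C P)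
  {v : List I}

/-- The operator on `Sym(P)` at a position `t` of the word `v`: the divided difference at `t ∈ X`,
`f ↦ -α s(f)` at `t ∈ Y`, the identity at `t ∈ Z`, and the simple reflection otherwise. -/
def positionOp (X Y Z : Finset (Fin v.length)) (t : Fin v.length) (f : SymmetricAlgebra ℤ P) :
    SymmetricAlgebra ℤ P :=
  if t ∈ Z then f else if t ∈ X then divDiff D (v.get t) f
  else if t ∈ Y then -(NilHecke.rootS D (v.get t) * D.symHom (C.cs.simple (v.get t)) f)
  else D.symHom (C.cs.simple (v.get t)) f

/-- The product of the operators `positionOp` over a list of positions. -/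
def positionOps (X Y Z : Finset (Fin v.length)) (L : List (Fin v.length))
    (f : SymmetricAlgebra ℤ P) : SymmetricAlgebra ℤ P :=
  L.foldr (positionOp D X Y Z) f

variable {D}

theorem positionOps_cons (X Y Z : Finset (Fin v.length)) (t : Fin v.length)
    (L : List (Fin v.length)) (f : SymmetricAlgebra ℤ P) :
    positionOps D X Y Z (t :: L) f = positionOp D X Y Z t (positionOps D X Y Z L f) := rfl

theorem positionOps_nil (X Y Z : Finset (Fin v.length)) (f : SymmetricAlgebra ℤ P) :
    positionOps D X Y Z [] f = f := rfl

theorem positionOps_congr {X Y Z X' Y' Z' : Finset (Fin v.length)} {L : List (Fin v.length)}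
    (hX : ∀ t ∈ L, (t ∈ X ↔ t ∈ X')) (hY : ∀ t ∈ L, (t ∈ Y ↔ t ∈ Y'))
    (hZ : ∀ t ∈ L, (t ∈ Z ↔ t ∈ Z')) (f : SymmetricAlgebra ℤ P) :
    positionOps D X Y Z L f = positionOps D X' Y' Z' L f := by
  induction L with
  | nil => rfl
  | cons t L ih =>
    rw [positionOps_cons, positionOps_cons, ih (fun t ht => hX t (by simp [ht]))
      (fun t ht => hY t (by simp [ht])) (fun t ht => hZ t (by simp [ht])), positionOp, positionOp]
    simp only [hX t (by simp), hY t (by simp), hZ t (by simp)]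

variable [Module.Free ℤ P] (D)

/-- The expansion of the coproduct along a word: at every position one acts on the first factor, on
the second factor, on both factors, or on the coefficient. -/
theorem NilHecke.coproduct_wordProduct (L : List (Fin v.length)) (hL : L.Pairwise (· < ·)) :
    coproduct D (wordProduct (gen D) (L.map v.get)) =
      ∑ X ∈ L.toFinset.powerset, ∑ Y ∈ (L.toFinset \ X).powerset,
        ∑ u ∈ ((L.toFinset \ X) \ Y).powerset,
          positionOps D X Y ∅ L 1 •
            (wordProduct (gen D) (subwordAt v (u ∪ Y)) ⊗ₜ[SymmetricAlgebra ℤ P]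
              wordProduct (gen D) (subwordAt v ((((L.toFinset \ X) \ Y) \ u) ∪ Y))) := by
  induction L with
  | nil => simp [wordProduct_nil, coproduct_one, positionOps_nil, subwordAt_empty]
  | cons t L ih =>
    obtain ⟨ht, hL'⟩ := List.pairwise_cons.mp hL
    rw [List.map_cons, wordProduct_cons, coproduct_gen_mul, ih hL', List.toFinset_cons]
    set F := L.toFinset with hF
    have hlt : ∀ b ∈ F, t < b := fun b hb => ht b (List.mem_toFinset.mp hb)
    have htF : t ∉ F := fun h => lt_irrefl _ (hlt t h)
    -- The new position `t` lies in `X`, in `Y`, in `u` or in none of them; these four choices match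
    -- the four terms of `A_t` acting on a scalar multiple of a pure tensor.
    rw [map_sum, Finset.sum_powerset_insert htF, ← Finset.sum_add_distrib]
    refine Finset.sum_congr rfl fun X hX => ?_
    rw [Finset.mem_powerset] at hX
    have htX : t ∉ X := fun h => htF (hX h)
    have htFX : t ∉ F \ X := fun h => htF (Finset.sdiff_subset h)
    rw [Finset.insert_sdiff_of_notMem _ htX, Finset.insert_sdiff_insert,
      Finset.sdiff_insert_of_notMem htF, Finset.sum_powerset_insert htFX, map_sum,
      ← Finset.sum_add_distrib, ← Finset.sum_add_distrib]
    refine Finset.sum_congr rfl fun Y hY => ?_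
    rw [Finset.mem_powerset] at hY
    have htY : t ∉ Y := fun h => htFX (hY h)
    have htFXY : t ∉ (F \ X) \ Y := fun h => htFX (Finset.sdiff_subset h)
    have hYF : Y ⊆ F := hY.trans Finset.sdiff_subset
    rw [Finset.insert_sdiff_of_notMem _ htY, Finset.insert_sdiff_insert,
      Finset.sdiff_insert_of_notMem htFX, Finset.sum_powerset_insert htFXY, map_sum,
      ← Finset.sum_add_distrib, ← Finset.sum_add_distrib, ← Finset.sum_add_distrib]
    refine Finset.sum_congr rfl fun u hu => ?_
    rw [Finset.mem_powerset] at hu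
    have htu : t ∉ u := fun h => htFXY (hu h)
    have huF : u ⊆ F := (hu.trans Finset.sdiff_subset).trans Finset.sdiff_subset
    set R := ((F \ X) \ Y) \ u with hR
    have hRF : R ⊆ F :=
      (Finset.sdiff_subset.trans Finset.sdiff_subset).trans Finset.sdiff_subset
    have e1 : insert t ((F \ X) \ Y) \ u = insert t R := Finset.insert_sdiff_of_notMem _ htu
    have e2 : insert t ((F \ X) \ Y) \ insert t u = R := by
      rw [Finset.insert_sdiff_insert, Finset.sdiff_insert_of_notMem htFXY]
    have w1 : ∀ p ⊆ F, subwordAt v (insert t p ∪ Y) = v.get t :: subwordAt v (p ∪ Y) := by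
      intro p hp
      rw [Finset.insert_union]
      exact subwordAt_insert fun b hb => hlt b (Finset.union_subset hp hYF hb)
    have w2 : ∀ p ⊆ F, subwordAt v (p ∪ insert t Y) = v.get t :: subwordAt v (p ∪ Y) := by
      intro p hp
      rw [Finset.union_insert]
      exact subwordAt_insert fun b hb => hlt b (Finset.union_subset hp hYF hb)
    have htL : ∀ b ∈ L, b ≠ t := fun b hb h => lt_irrefl _ (h ▸ ht b hb)
    have o1 : positionOps D X Y ∅ (t :: L) 1 =
        D.symHom (C.cs.simple (v.get t)) (positionOps D X Y ∅ L 1) := by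
      rw [positionOps_cons, positionOp, if_neg (by simp), if_neg htX, if_neg htY]
    have o2 : positionOps D X (insert t Y) ∅ (t :: L) 1 =
        -(rootS D (v.get t) * D.symHom (C.cs.simple (v.get t)) (positionOps D X Y ∅ L 1)) := by
      rw [positionOps_cons, positionOp, if_neg (by simp), if_neg htX, if_pos (by simp),
        positionOps_congr (Y' := Y) (fun _ _ => Iff.rfl) (fun b hb => by simp [htL b hb])
          (fun _ _ => Iff.rfl)]
    have o3 : positionOps D (insert t X) Y ∅ (t :: L) 1 =
        divDiff D (v.get t) (positionOps D X Y ∅ L 1) := by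
      rw [positionOps_cons, positionOp, if_neg (by simp), if_pos (by simp),
        positionOps_congr (X' := X) (fun b hb => by simp [htL b hb]) (fun _ _ => Iff.rfl)
          (fun _ _ => Iff.rfl)]
    have hneg : ∀ (a : SymmetricAlgebra ℤ P) (x : TensorSquare D), (-a) • x = -(a • x) :=
      fun a x => neg_smul a x
    rw [e1, e2, w1 u huF, w1 R hRF, w2 u huF, w2 R hRF, o1, o2, o3, genAct_smul, genAct_tmul]
    simp only [wordProduct_cons, smul_sub, smul_add, hneg, ← TensorProduct.smul_tmul', smul_smul]
    rw [mul_comm (rootS D _)]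
    abel

end AffineNilHecke

end

noncomputable section

namespace AffineNilHecke

open CoxeterSystem
open scoped TensorProduct

variable {I : Type*} {C : CartanDatum I} {P : Type*} [AddCommGroup P] (D : Realization C P)
  {v : List I}

/-! ### Subwords as expansions of products of reflections -/

section Paths

theorem bWord_insert {t : Fin v.length} {p : Finset (Fin v.length)} (h : ∀ b ∈ p, t < b)
    (hp : p.Nonempty) : bWord C (subwordAt v (insert t p)) =
      -C.a (v.get t) (v.get (p.min' hp)) * bWord C (subwordAt v p) := by
  have hm : p = insert (p.min' hp) (p.erase (p.min' hp)) :=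
    (Finset.insert_erase (p.min'_mem hp)).symm
  have hlt : ∀ b ∈ p.erase (p.min' hp), p.min' hp < b := fun b hb =>
    lt_of_le_of_ne (p.min'_le b (Finset.mem_of_mem_erase hb)) (Finset.ne_of_mem_erase hb).symm
  have e := subwordAt_insert hlt
  rw [← hm] at e
  rw [subwordAt_insert h, e, bWord]

/-- The action of the simple reflections at the positions of a list, those in `Z` excepted. -/
def weightOps (Z : Finset (Fin v.length)) (L : List (Fin v.length)) (l : P) : P :=
  L.foldr (fun t l => if t ∈ Z then l else D.reflect (v.get t) l) l

theorem weightOps_cons (Z : Finset (Fin v.length)) (t : Fin v.length) (L : List (Fin v.length))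
    (l : P) : weightOps D Z (t :: L) l =
      if t ∈ Z then weightOps D Z L l else D.reflect (v.get t) (weightOps D Z L l) := rfl

theorem Realization.reflect_sum {ι : Type*} (i : I) (S : Finset ι) (c : ι → ℤ) (l : ι → P) :
    D.reflect i (∑ k ∈ S, c k • l k) = ∑ k ∈ S, c k • D.reflect i (l k) := by
  exact (map_sum (D.reflectEquiv i) _ S).trans
    (Finset.sum_congr rfl fun k _ => map_smul (D.reflectEquiv i) (c k) (l k))

/-- Since `s_t α_q = α_q + b_{tq} α_t`, each reflection either skips position `t` or prepends it to
the subword chosen so far, at the cost of one factor `b`. -/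
theorem weightOps_root (Z : Finset (Fin v.length)) {L : List (Fin v.length)}
    (hL : L.Pairwise (· < ·)) {y : Fin v.length} (hy : ∀ t ∈ L, t < y) :
    weightOps D Z L (D.root (v.get y)) = ∑ q ∈ (L.toFinset \ Z).powerset,
      bWord C (subwordAt v (insert y q)) •
        D.root (v.get ((insert y q).min' (Finset.insert_nonempty y q))) := by
  induction L with
  | nil =>
    have : subwordAt v ({y} : Finset (Fin v.length)) = [v.get y] := by
      rw [← insert_empty_eq, subwordAt_insert (by simp), subwordAt_empty]
    simp [weightOps, this, bWord]
  | cons t L ih =>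
    obtain ⟨ht, hL'⟩ := List.pairwise_cons.mp hL
    rw [weightOps_cons, ih hL' fun t ht => hy t (by simp [ht]), List.toFinset_cons]
    split_ifs with htZ
    · rw [Finset.insert_sdiff_of_mem _ htZ]
    · have htF : t ∉ L.toFinset \ Z := fun h =>
        lt_irrefl _ (ht t (List.mem_toFinset.mp (Finset.sdiff_subset h)))
      rw [Finset.insert_sdiff_of_notMem _ htZ, Finset.sum_powerset_insert htF,
        Realization.reflect_sum, ← Finset.sum_add_distrib]
      refine Finset.sum_congr rfl fun q hq => ?_
      have hlt : ∀ b ∈ insert y q, t < b := by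
        intro b hb
        rcases Finset.mem_insert.mp hb with rfl | hb
        · exact hy t (by simp)
        · exact ht b (List.mem_toFinset.mp (Finset.sdiff_subset (Finset.mem_powerset.mp hq hb)))
      have hmin : (insert y (insert t q)).min' (Finset.insert_nonempty _ _) = t := by
        refine le_antisymm (Finset.min'_le _ _ (by simp)) (Finset.le_min' _ _ _ fun b hb => ?_)
        rw [Finset.insert_comm, Finset.mem_insert] at hb
        rcases hb with rfl | hb
        · exact le_rfl
        · exact (hlt b hb).le
      rw [hmin, Finset.insert_comm, bWord_insert hlt (Finset.insert_nonempty y q),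
        Realization.reflect, D.pairing]
      module

/-- Pairing the expansion of `weightOps_root` with the coroot at `x` supplies the last factor `b`,
that of the step from `x` to the next letter. -/
theorem sum_bWord_eq (Z : Finset (Fin v.length)) {L : List (Fin v.length)}
    (hL : L.Pairwise (· < ·)) {x y : Fin v.length} (hxy : x < y) (hy : ∀ t ∈ L, t < y)
    (hx : ∀ t ∈ L, x < t) :
    ∑ q ∈ (L.toFinset \ Z).powerset, bWord C (subwordAt v (insert x (insert y q))) =
      -D.coroot (v.get x) (weightOps D Z L (D.root (v.get y))) := by
  rw [weightOps_root D Z hL hy, map_sum, ← Finset.sum_neg_distrib]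
  refine Finset.sum_congr rfl fun q hq => ?_
  rw [bWord_insert (fun b hb => ?_) (Finset.insert_nonempty y q), map_smul, D.pairing, smul_eq_mul]
  · ring
  · rcases Finset.mem_insert.mp hb with rfl | hb
    · exact hxy
    · exact hx b (List.mem_toFinset.mp (Finset.sdiff_subset (Finset.mem_powerset.mp hq hb)))

end Paths

/-! ### The twisted Leibniz rule -/

section Leibniz

variable [Module.Free ℤ P]

/-- The divided difference operator as an additive map. -/
def divDiffHom (i : I) : SymmetricAlgebra ℤ P →+ SymmetricAlgebra ℤ P :=
  AddMonoidHom.mk' (divDiff D i) (divDiff_add D i)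

theorem divDiff_sum_intCast_mul {ι : Type*} (i : I) (S : Finset ι) (c : ι → ℤ)
    (f : ι → SymmetricAlgebra ℤ P) :
    divDiff D i (∑ k ∈ S, (c k : SymmetricAlgebra ℤ P) * f k) =
      ∑ k ∈ S, (c k : SymmetricAlgebra ℤ P) * divDiff D i (f k) := by
  refine (map_sum (divDiffHom D i) _ S).trans (Finset.sum_congr rfl fun k _ => ?_)
  change divDiff D i _ = _
  rw [divDiff_mul, divDiff_intCast, zero_mul, zero_add, map_intCast]

theorem positionOps_neg (X Y Z : Finset (Fin v.length)) (L : List (Fin v.length))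
    (f : SymmetricAlgebra ℤ P) : positionOps D X Y Z L (-f) = -positionOps D X Y Z L f := by
  induction L with
  | nil => rfl
  | cons t L ih =>
    rw [positionOps_cons, positionOps_cons, ih]
    simp only [positionOp]
    split_ifs
    · rfl
    · exact map_neg (divDiffHom D _) _
    · rw [map_neg, mul_neg]
    · rw [map_neg]

/-- The twisted Leibniz rule for a product of simple reflections and divided differences. -/
theorem positionOps_mul {X Y Z : Finset (Fin v.length)} (hXZ : Disjoint X Z)
    {L : List (Fin v.length)} (hL : L.Pairwise (· < ·)) (hY : ∀ t ∈ L, t ∉ Y) (l : P)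
    (g : SymmetricAlgebra ℤ P) :
    positionOps D X Y Z L (SymmetricAlgebra.ι ℤ P l * g) =
      SymmetricAlgebra.ι ℤ P (weightOps D Z L l) * positionOps D X Y Z L g +
        ∑ x ∈ L.toFinset ∩ X,
          ((D.coroot (v.get x) (weightOps D Z (L.filter (x < ·)) l) : ℤ) : SymmetricAlgebra ℤ P) *
            positionOps D (X.erase x) Y (insert x Z) L g := by
  induction L with
  | nil => simp [positionOps_nil, weightOps]
  | cons t L ih =>
    obtain ⟨ht, hL'⟩ := List.pairwise_cons.mp hL
    have htL : t ∉ L := fun h => lt_irrefl _ (ht t h)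
    have htF : t ∉ L.toFinset ∩ X := fun h =>
      htL (List.mem_toFinset.mp (Finset.inter_subset_left h))
    have htY : t ∉ Y := hY t (by simp)
    have hne : ∀ x ∈ L.toFinset ∩ X, t ≠ x := fun x hx h => htF (h ▸ hx)
    have hfil : ∀ x ∈ L.toFinset ∩ X, (t :: L).filter (x < ·) = L.filter (x < ·) := by
      intro x hx
      have := ht x (List.mem_toFinset.mp (Finset.inter_subset_left hx))
      rw [List.filter_cons_of_neg (by simpa using this.le)]
    rw [positionOps_cons, ih hL' fun t ht => hY t (by simp [ht]), List.toFinset_cons,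
      weightOps_cons]
    by_cases htZ : t ∈ Z
    · have htX : t ∉ X := fun h => Finset.disjoint_left.mp hXZ h htZ
      rw [if_pos htZ, Finset.insert_inter_of_notMem htX, positionOp, if_pos htZ, positionOps_cons,
        positionOp, if_pos htZ]
      congr 1
      refine Finset.sum_congr rfl fun x hx => ?_
      rw [hfil x hx, positionOps_cons, positionOp, if_pos (Finset.mem_insert_of_mem htZ)]
    · rw [if_neg htZ]
      -- At a divided difference the rule `∂(l g) = ∂(l) g + s(l) ∂(g)` applies. Either `t` hits the
      -- weight and then acts on `g` as the identity, that is, moves from `X` to `Z`, or it reflects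
      -- the weight and still differentiates `g`.
      by_cases htX : t ∈ X
      · rw [Finset.insert_inter_of_mem htX, Finset.sum_insert htF, positionOp, if_neg htZ,
          if_pos htX, positionOps_cons X Y Z, positionOp, if_neg htZ, if_pos htX, divDiff_add,
          divDiff_mul, divDiff_ι, D.symHom_simple_ι, divDiff_sum_intCast_mul,
          List.filter_cons_of_neg (by simp), List.filter_eq_self.mpr (by simpa using ht),
          positionOps_cons, positionOp, if_pos (Finset.mem_insert_self t Z)]
        have e1 : positionOps D (X.erase t) Y (insert t Z) L g = positionOps D X Y Z L g := by
          refine positionOps_congr (fun b hb => ?_) (fun _ _ => Iff.rfl) (fun b hb => ?_) g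
          · have : b ≠ t := fun h => htL (h ▸ hb)
            simp [this]
          · have : b ≠ t := fun h => htL (h ▸ hb)
            simp [this]
        have e2 : ∑ x ∈ L.toFinset ∩ X, ((D.coroot (v.get x)
            (weightOps D Z ((t :: L).filter (x < ·)) l) : ℤ) : SymmetricAlgebra ℤ P) *
              positionOps D (X.erase x) Y (insert x Z) (t :: L) g =
            ∑ x ∈ L.toFinset ∩ X, ((D.coroot (v.get x)
              (weightOps D Z (L.filter (x < ·)) l) : ℤ) : SymmetricAlgebra ℤ P) *
                divDiff D (v.get t) (positionOps D (X.erase x) Y (insert x Z) L g) := by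
          refine Finset.sum_congr rfl fun x hx => ?_
          rw [hfil x hx, positionOps_cons, positionOp, if_neg (by simp [hne x hx, htZ]),
            if_pos (by simp [hne x hx, htX])]
        rw [e1, e2]
        ring
      · rw [Finset.insert_inter_of_notMem htX, positionOp, if_neg htZ, if_neg htX, if_neg htY,
          positionOps_cons X Y Z, positionOp, if_neg htZ, if_neg htX, if_neg htY, map_add,
          map_mul, D.symHom_simple_ι, map_sum]
        congr 1
        refine Finset.sum_congr rfl fun x hx => ?_
        rw [hfil x hx, positionOps_cons, positionOp, if_neg (by simp [hne x hx, htZ]),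
          if_neg (by simp [htX]), if_neg htY, map_mul, map_intCast]

/-- Reflections fix `1`, and divided differences kill both `1` and `0`. This is the base case in
which no last letters are left. -/
theorem positionOps_one {X Z : Finset (Fin v.length)} (hXZ : Disjoint X Z)
    (L : List (Fin v.length)) :
    positionOps D X ∅ Z L 1 = if L.toFinset ∩ X = ∅ then 1 else 0 := by
  induction L with
  | nil => simp [positionOps_nil]
  | cons t L ih =>
    rw [positionOps_cons, ih, positionOp, List.toFinset_cons]
    by_cases htX : t ∈ X
    · rw [if_neg (Finset.disjoint_left.mp hXZ htX), if_pos htX, Finset.insert_inter_of_mem htX,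
        if_neg (Finset.insert_ne_empty _ _)]
      split_ifs
      · exact divDiff_one D _
      · exact divDiff_zero D _
    · rw [Finset.insert_inter_of_notMem htX, if_neg htX]
      simp only [Finset.notMem_empty, if_false]
      split_ifs <;> simp

end Leibniz

/-! ### Recursion for admissible tuples -/

section Tuples

variable {n k : ℕ}

/-- Admissible tuples with prescribed sets of first and last letters which avoid the positions
in `Z`. -/
def IsCompatible (X Y Z : Finset (Fin n)) (T : Fin k → Subword n) : Prop :=
  IsAdmissible T ∧ firsts T = X ∧ lasts T = Y ∧ ∀ i, Disjoint (T i).1 Z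

theorem Subword.first_mem (p : Subword n) : p.first ∈ p.1 := Finset.min'_mem _ _

theorem Subword.last_mem (p : Subword n) : p.last ∈ p.1 := Finset.max'_mem _ _

theorem Subword.first_lt_last (p : Subword n) : p.first < p.last :=
  Finset.min'_lt_max'_of_card _ p.2

theorem firsts_cons (p : Subword n) (T : Fin k → Subword n) :
    firsts (Fin.cons p T : Fin (k + 1) → Subword n) = insert p.first (firsts T) := by
  ext a
  simp [firsts, Fin.exists_fin_succ, eq_comm]

theorem lasts_cons (p : Subword n) (T : Fin k → Subword n) :
    lasts (Fin.cons p T : Fin (k + 1) → Subword n) = insert p.last (lasts T) := by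
  ext a
  simp [lasts, Fin.exists_fin_succ, eq_comm]

/-- The last letters increase, so the first subword ends at the minimum of `Y`; its own first letter
becomes forbidden for all later subwords and so joins `Z`. Disjointness of `X` and `Y` encodes that
no first letter is a last letter. -/
theorem isCompatible_cons {X Y Z : Finset (Fin n)} (hXY : Disjoint X Y) (hY : Y.Nonempty)
    (p : Subword n) (T : Fin k → Subword n) :
    IsCompatible X Y Z (Fin.cons p T : Fin (k + 1) → Subword n) ↔
      (p.first ∈ X ∧ p.last = Y.min' hY ∧ Disjoint p.1 Z) ∧
        IsCompatible (X.erase p.first) (Y.erase (Y.min' hY)) (insert p.first Z) T := by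
  constructor
  · rintro ⟨⟨h1, h2, h3⟩, hX, hY', hZ⟩
    rw [firsts_cons] at hX
    rw [lasts_cons] at hY'
    have hlt : ∀ i, p.last < (T i).last := fun i => by
      have := h2 (Fin.succ_pos i)
      simpa using this
    have havoid : ∀ i, p.first ∉ (T i).1 := fun i => by
      have := h1 i.succ 0 (Fin.succ_pos i)
      simpa using this
    have hf : p.first ∉ firsts T := by
      intro h
      obtain ⟨i, -, hi⟩ := Finset.mem_image.mp h
      exact havoid i (hi ▸ (T i).first_mem)
    have hl : p.last ∉ lasts T := by
      intro h
      obtain ⟨i, -, hi⟩ := Finset.mem_image.mp h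
      exact (hlt i).ne hi.symm
    have hmin : p.last = Y.min' hY := by
      refine le_antisymm (Finset.le_min' _ _ _ fun b hb => ?_)
        (Finset.min'_le _ _ (hY' ▸ Finset.mem_insert_self _ _))
      rw [← hY', Finset.mem_insert] at hb
      rcases hb with rfl | hb
      · exact le_rfl
      · obtain ⟨i, -, rfl⟩ := Finset.mem_image.mp hb
        exact (hlt i).le
    refine ⟨⟨hX ▸ Finset.mem_insert_self _ _, hmin, by simpa using hZ 0⟩, ⟨fun i j hij => ?_,
      fun i j hij => ?_, fun i j => ?_⟩, ?_, ?_, fun i => ?_⟩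
    · simpa using h1 i.succ j.succ (Fin.succ_lt_succ_iff.mpr hij)
    · simpa using h2 (Fin.succ_lt_succ_iff.mpr hij)
    · simpa using h3 i.succ j.succ
    · rw [← hX, Finset.erase_insert hf]
    · rw [← hmin, ← hY', Finset.erase_insert hl]
    · rw [Finset.disjoint_insert_right]
      exact ⟨havoid i, by simpa using hZ i.succ⟩
  · rintro ⟨⟨hp, hmin, hpZ⟩, ⟨h1, h2, h3⟩, hX, hY', hZ⟩
    have hX' : firsts (Fin.cons p T : Fin (k + 1) → Subword n) = X := by
      rw [firsts_cons, hX, Finset.insert_erase hp]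
    have hY'' : lasts (Fin.cons p T : Fin (k + 1) → Subword n) = Y := by
      rw [lasts_cons, hY', hmin, Finset.insert_erase (Y.min'_mem hY)]
    have hlt : ∀ i, p.last < (T i).last := by
      intro i
      have hm : (T i).last ∈ Y.erase (Y.min' hY) :=
        hY'.subset (Finset.mem_image_of_mem _ (Finset.mem_univ i))
      rw [hmin]
      exact lt_of_le_of_ne (Finset.min'_le _ _ (Finset.mem_of_mem_erase hm))
        (Finset.ne_of_mem_erase hm).symm
    refine ⟨⟨fun i j hij => ?_, fun i j hij => ?_, fun i j h => ?_⟩, hX', hY'', fun i => ?_⟩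
    · induction i using Fin.cases with
      | zero => exact absurd hij (Fin.not_lt_zero j)
      | succ i =>
        induction j using Fin.cases with
        | zero => simpa using (Finset.disjoint_insert_right.mp (hZ i)).1
        | succ j => simpa using h1 i j (Fin.succ_lt_succ_iff.mp hij)
    · induction j using Fin.cases with
      | zero => exact absurd hij (Fin.not_lt_zero i)
      | succ j =>
        induction i using Fin.cases with
        | zero => simpa using hlt j
        | succ i => simpa using h2 (Fin.succ_lt_succ_iff.mp hij)
    · have hi : ((Fin.cons p T : Fin (k + 1) → Subword n) i).first ∈ X :=
        hX'.subset (Finset.mem_image_of_mem _ (Finset.mem_univ i))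
      have hj : ((Fin.cons p T : Fin (k + 1) → Subword n) j).last ∈ Y :=
        hY''.subset (Finset.mem_image_of_mem _ (Finset.mem_univ j))
      exact Finset.disjoint_left.mp hXY hi (h ▸ hj)
    · induction i using Fin.cases with
      | zero => simpa using hpZ
      | succ i => simpa using (Finset.disjoint_insert_right.mp (hZ i)).2

open Classical in
/-- The sum of the coefficients of all compatible tuples. -/
def tupleSum (C : CartanDatum I) (v : List I) (k : ℕ) (X Y Z : Finset (Fin v.length)) : ℤ :=
  ∑ T : Fin k → Subword v.length, if IsCompatible X Y Z T then bTuple C v T else 0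

open Classical in
theorem tupleSum_succ {X Y Z : Finset (Fin v.length)} (hXY : Disjoint X Y) (hY : Y.Nonempty) :
    tupleSum C v (k + 1) X Y Z = ∑ p : Subword v.length,
      if p.first ∈ X ∧ p.last = Y.min' hY ∧ Disjoint p.1 Z then
        bWord C (subwordAt v p.1) *
          tupleSum C v k (X.erase p.first) (Y.erase (Y.min' hY)) (insert p.first Z) else 0 := by
  rw [tupleSum, ← (Fin.consEquiv fun _ => Subword v.length).sum_comp, Fintype.sum_prod_type]
  refine Finset.sum_congr rfl fun p _ => ?_
  split_ifs with hp
  · rw [tupleSum, Finset.mul_sum]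
    refine Finset.sum_congr rfl fun T _ => ?_
    change (if IsCompatible X Y Z (Fin.cons p T : Fin (k + 1) → Subword v.length) then
      bTuple C v (Fin.cons p T : Fin (k + 1) → Subword v.length) else 0) = _
    rw [isCompatible_cons hXY hY]
    simp only [hp, true_and, bTuple, Fin.prod_univ_succ, Fin.cons_zero, Fin.cons_succ, mul_ite,
      mul_zero]
  · refine Finset.sum_eq_zero fun T _ => if_neg ?_
    change ¬ IsCompatible X Y Z (Fin.cons p T : Fin (k + 1) → Subword v.length)
    rw [isCompatible_cons hXY hY]
    exact fun h => hp h.1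

open Classical in
theorem tupleSum_zero (X Z : Finset (Fin v.length)) :
    tupleSum C v 0 X ∅ Z = if X = ∅ then 1 else 0 := by
  rw [tupleSum, Fintype.sum_unique]
  have h : IsCompatible X ∅ Z (default : Fin 0 → Subword v.length) ↔ X = ∅ := by
    constructor
    · rintro ⟨-, h, -⟩
      rw [← h]; rfl
    · rintro rfl
      exact ⟨⟨fun i => i.elim0, fun i => i.elim0, fun i => i.elim0⟩, rfl, rfl, fun i => i.elim0⟩
  simp only [h, bTuple, Finset.univ_eq_empty, Finset.prod_empty]

-- A subword from `x` to `y` is determined by its set `q` of inner positions.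
open Classical in
theorem sum_subword_eq {x y : Fin v.length} (hxy : x < y) {Z : Finset (Fin v.length)}
    (hxZ : x ∉ Z) (hyZ : y ∉ Z) :
    (∑ p : Subword v.length, if p.first = x ∧ p.last = y ∧ Disjoint p.1 Z then
      bWord C (subwordAt v p.1) else 0) =
      ∑ q ∈ (Finset.Ioo x y \ Z).powerset, bWord C (subwordAt v (insert x (insert y q))) := by
  rw [← Finset.sum_filter]
  symm
  have hbound : ∀ q ∈ (Finset.Ioo x y \ Z).powerset, ∀ b ∈ q, (x < b ∧ b < y) ∧ b ∉ Z := by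
    intro q hq b hb
    have := Finset.mem_powerset.mp hq hb
    rwa [Finset.mem_sdiff, Finset.mem_Ioo] at this
  have hcard : ∀ q ∈ (Finset.Ioo x y \ Z).powerset, 2 ≤ (insert x (insert y q)).card := by
    intro q _
    calc 2 = ({x, y} : Finset (Fin v.length)).card := (Finset.card_pair hxy.ne).symm
      _ ≤ _ := Finset.card_le_card (by intro b; simp; tauto)
  refine Finset.sum_bij (fun q hq => ⟨insert x (insert y q), hcard q hq⟩) ?_ ?_ ?_ ?_
  · intro q hq
    rw [Finset.mem_filter]
    refine ⟨Finset.mem_univ _, ?_, ?_, ?_⟩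
    · refine le_antisymm (Finset.min'_le _ _ (by simp)) (Finset.le_min' _ _ _ fun b hb => ?_)
      simp only [Finset.mem_insert] at hb
      rcases hb with rfl | rfl | hb
      · exact le_rfl
      · exact hxy.le
      · exact (hbound q hq b hb).1.1.le
    · refine le_antisymm (Finset.max'_le _ _ _ fun b hb => ?_) (Finset.le_max' _ _ (by simp))
      simp only [Finset.mem_insert] at hb
      rcases hb with rfl | rfl | hb
      · exact hxy.le
      · exact le_rfl
      · exact (hbound q hq b hb).1.2.le
    · simp only [Finset.disjoint_insert_left]
      exact ⟨hxZ, hyZ, Finset.disjoint_left.mpr fun b hb => (hbound q hq b hb).2⟩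
  · intro q hq q' hq' h
    have h' : insert x (insert y q) = insert x (insert y q') := congrArg Subtype.val h
    ext b
    have := Finset.ext_iff.mp h' b
    simp only [Finset.mem_insert] at this
    constructor
    · intro hb
      have hb' := (hbound q hq b hb).1
      rcases this.mp (Or.inr (Or.inr hb)) with rfl | rfl | h
      · exact absurd hb'.1 (lt_irrefl _)
      · exact absurd hb'.2 (lt_irrefl _)
      · exact h
    · intro hb
      have hb' := (hbound q' hq' b hb).1
      rcases this.mpr (Or.inr (Or.inr hb)) with rfl | rfl | h
      · exact absurd hb'.1 (lt_irrefl _)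
      · exact absurd hb'.2 (lt_irrefl _)
      · exact h
  · intro p hp
    obtain ⟨-, rfl, rfl, hZ⟩ := Finset.mem_filter.mp hp
    refine ⟨(p.1.erase p.first).erase p.last, ?_, ?_⟩
    · rw [Finset.mem_powerset]
      intro b hb
      simp only [Finset.mem_erase] at hb
      rw [Finset.mem_sdiff, Finset.mem_Ioo]
      exact ⟨⟨lt_of_le_of_ne (Finset.min'_le _ _ hb.2.2) hb.2.1.symm,
        lt_of_le_of_ne (Finset.le_max' _ _ hb.2.2) hb.1⟩, Finset.disjoint_left.mp hZ hb.2.2⟩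
    · apply Subtype.ext
      change insert p.first (insert p.last _) = p.1
      rw [Finset.insert_erase (Finset.mem_erase.mpr ⟨hxy.ne', p.last_mem⟩),
        Finset.insert_erase p.first_mem]
  · intro q hq
    rfl

end Tuples

/-! ### Evaluation of the coefficients at zero -/

section Evaluation

theorem positionOps_append (X Y Z : Finset (Fin v.length)) (L L' : List (Fin v.length))
    (f : SymmetricAlgebra ℤ P) :
    positionOps D X Y Z (L ++ L') f = positionOps D X Y Z L (positionOps D X Y Z L' f) :=
  List.foldr_append ..

theorem filter_lt_append_cons_filter_gt {α : Type*} [LinearOrder α] {L : List α}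
    (hL : L.Pairwise (· < ·)) {y : α} (hy : y ∈ L) :
    L = L.filter (· < y) ++ y :: L.filter (y < ·) := by
  induction L with
  | nil => simp at hy
  | cons t L ih =>
    obtain ⟨ht, hL'⟩ := List.pairwise_cons.mp hL
    rcases List.mem_cons.mp hy with rfl | hy
    · rw [List.filter_cons_of_neg (by simp), List.filter_cons_of_neg (by simp),
        List.filter_eq_nil_iff.mpr (fun b hb => by simpa using (ht b hb).le),
        List.filter_eq_self.mpr (fun b hb => by simpa using ht b hb), List.nil_append]
    · rw [List.filter_cons_of_pos (by simpa using ht y hy),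
        List.filter_cons_of_neg (by simpa using (ht y hy).le), List.cons_append, ← ih hL' hy]

variable [Module.Free ℤ P]

/-- The value at zero of a product of reflections, divided differences and multiplications by
simple roots, as a sum over admissible tuples. -/
theorem evalZero_positionOps {X Y Z : Finset (Fin v.length)} (hXY : Disjoint X Y)
    (hXZ : Disjoint X Z) (hYZ : Disjoint Y Z) :
    NilHecke.evalZero P (positionOps D X Y Z (List.finRange v.length) 1) =
      tupleSum C v Y.card X Y Z := by
  classical
  induction hk : Y.card generalizing X Y Z with
  | zero =>
    obtain rfl := Finset.card_eq_zero.mp hk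
    rw [positionOps_one D hXZ, tupleSum_zero]
    simp only [List.toFinset_finRange, Finset.univ_inter]
    split_ifs <;> simp
  | succ k ih =>
    have hY : Y.Nonempty := Finset.card_pos.mp (by omega)
    -- The minimum of `Y` is the leftmost root factor, so only reflections, divided differences and
    -- frozen positions stand to its left, as the Leibniz rule requires.
    set y := Y.min' hY with hy
    have hyY : y ∈ Y := Y.min'_mem hY
    have hsort : (List.finRange v.length).Pairwise (· < ·) := List.pairwise_lt_finRange _
    have hsplit := filter_lt_append_cons_filter_gt hsort (List.mem_finRange y)
    set L₁ := (List.finRange v.length).filter (· < y) with hL₁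
    set L₂ := (List.finRange v.length).filter (y < ·) with hL₂
    have m₁ : ∀ t, t ∈ L₁ ↔ t < y := by simp [hL₁]
    have m₂ : ∀ t, t ∈ L₂ ↔ y < t := by simp [hL₂]
    have hyX : y ∉ X := fun h => Finset.disjoint_left.mp hXY h hyY
    have hyZ : y ∉ Z := Finset.disjoint_left.mp hYZ hyY
    -- Once the root at `y` has been hit by the divided difference at `x`, position `y` is a plain
    -- reflection and `x` is frozen: this is the coefficient for `X \ {x}`, `Y \ {y}`, `Z ∪ {x}`, to
    -- which induction applies.
    have hterm : ∀ x ∈ L₁.toFinset ∩ X,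
        NilHecke.evalZero P (positionOps D (X.erase x) Y (insert x Z) L₁
          (D.symHom (C.cs.simple (v.get y)) (positionOps D X Y Z L₂ 1))) =
        tupleSum C v k (X.erase x) (Y.erase y) (insert x Z) := by
      intro x hx
      obtain ⟨hx₁, hxX⟩ := Finset.mem_inter.mp hx
      rw [List.mem_toFinset, m₁] at hx₁
      have hxY : x ∉ Y := Finset.disjoint_left.mp hXY hxX
      rw [← ih (X := X.erase x) (Y := Y.erase y) (Z := insert x Z)
        (hXY.mono (Finset.erase_subset _ _) (Finset.erase_subset _ _))
        (by
          rw [Finset.disjoint_insert_right]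
          exact ⟨Finset.notMem_erase _ _, hXZ.mono_left (Finset.erase_subset _ _)⟩)
        (by
          rw [Finset.disjoint_insert_right]
          exact ⟨fun h => hxY (Finset.mem_of_mem_erase h),
            hYZ.mono_left (Finset.erase_subset _ _)⟩)
        (by rw [Finset.card_erase_of_mem hyY, hk]; rfl)]
      conv_rhs => rw [hsplit]
      rw [positionOps_append, positionOps_cons, positionOp, if_neg (by simp [hx₁.ne', hyZ]),
        if_neg (by simp [hyX]), if_neg (by simp)]
      congr 1
      rw [positionOps_congr (X := X) (X' := X.erase x) (Y := Y) (Y' := Y.erase y) (Z := Z)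
        (Z' := insert x Z) (L := L₂)]
      · refine positionOps_congr (fun _ _ => Iff.rfl) (fun t ht => ?_) (fun _ _ => Iff.rfl) _
        have := ((m₁ t).mp ht).ne
        simp [this]
      · intro t ht
        have := (hx₁.trans ((m₂ t).mp ht)).ne'
        simp [this]
      · intro t ht
        have := ((m₂ t).mp ht).ne'
        simp [this]
      · intro t ht
        have := (hx₁.trans ((m₂ t).mp ht)).ne'
        simp [this]
    have hlhs : NilHecke.evalZero P (positionOps D X Y Z (List.finRange v.length) 1) =
        ∑ x ∈ L₁.toFinset ∩ X, -D.coroot (v.get x)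
          (weightOps D Z (L₁.filter (x < ·)) (D.root (v.get y))) *
            tupleSum C v k (X.erase x) (Y.erase y) (insert x Z) := by
      rw [hsplit, positionOps_append, positionOps_cons, positionOp, if_neg hyZ, if_neg hyX,
        if_pos hyY, positionOps_neg, NilHecke.rootS, positionOps_mul D hXZ (hsort.filter _), map_neg,
        map_add, map_mul, map_sum]
      · have h0 : ∀ l, NilHecke.evalZero P (SymmetricAlgebra.ι ℤ P l) = 0 :=
          SymmetricAlgebra.algebraMapInv_ι
        -- The term in which the weight survives every position is a multiple of an element of `P`,
        -- so it vanishes at zero.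
        rw [h0, zero_mul, zero_add, ← Finset.sum_neg_distrib]
        refine Finset.sum_congr rfl fun x hx => ?_
        rw [map_mul, map_intCast, hterm x hx, Int.cast_id, neg_mul]
      · intro t ht htY
        exact absurd (Finset.min'_le _ _ htY) (not_le_of_gt ((m₁ t).mp ht))
    rw [hlhs, tupleSum_succ hXY hY]
    -- Subwords are sorted by their first letter `x`; it lies left of `y` because a subword of
    -- length at least two begins before it ends.
    have hfib : ∀ p : Subword v.length, (if p.first ∈ X ∧ p.last = Y.min' hY ∧ Disjoint p.1 Z then
        bWord C (subwordAt v p.1) *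
          tupleSum C v k (X.erase p.first) (Y.erase (Y.min' hY)) (insert p.first Z) else 0) =
        ∑ x ∈ L₁.toFinset ∩ X, (if p.first = x ∧ p.last = y ∧ Disjoint p.1 Z then
          bWord C (subwordAt v p.1) else 0) *
            tupleSum C v k (X.erase x) (Y.erase y) (insert x Z) := by
      intro p
      split_ifs with h
      · have hm : p.first ∈ L₁.toFinset ∩ X := by
          rw [Finset.mem_inter, List.mem_toFinset, m₁]
          exact ⟨p.first_lt_last.trans_eq h.2.1, h.1⟩
        rw [Finset.sum_eq_single_of_mem _ hm, if_pos ⟨rfl, h.2⟩]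
        intro x _ hx
        rw [if_neg (fun h' => hx h'.1.symm), zero_mul]
      · symm
        refine Finset.sum_eq_zero fun x hx => ?_
        rw [if_neg, zero_mul]
        rintro ⟨rfl, h'⟩
        exact h ⟨(Finset.mem_inter.mp hx).2, h'⟩
    rw [Finset.sum_congr rfl fun p _ => hfib p, Finset.sum_comm]
    refine Finset.sum_congr rfl fun x hx => ?_
    obtain ⟨hx₁, hxX⟩ := Finset.mem_inter.mp hx
    rw [List.mem_toFinset, m₁] at hx₁
    rw [← Finset.sum_mul, sum_subword_eq hx₁ (Finset.disjoint_left.mp hXZ hxX) hyZ]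
    have hIoo : Finset.Ioo x y = (L₁.filter (x < ·)).toFinset := by
      ext b
      simp [m₁, and_comm]
    rw [hIoo, sum_bWord_eq D Z ((hsort.filter _).filter _) hx₁]
    · intro t ht
      exact (m₁ t).mp (List.mem_of_mem_filter ht)
    · intro t ht
      simpa using (List.mem_filter.mp ht).2

end Evaluation

end AffineNilHecke

end

/-! ### Regrouping the sum over tuples and conclusion -/

noncomputable section

namespace AffineNilHecke

open scoped TensorProduct

variable {I : Type*} {C : CartanDatum I} {v : List I}

theorem card_lasts {n k : ℕ} {T : Fin k → Subword n} (hT : IsAdmissible T) :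
    (lasts T).card = k := by
  rw [lasts, Finset.card_image_of_injective _ hT.2.1.injective, Finset.card_univ,
    Fintype.card_fin]

theorem disjoint_firsts_lasts {n k : ℕ} {T : Fin k → Subword n} (hT : IsAdmissible T) :
    Disjoint (firsts T) (lasts T) := by
  rw [Finset.disjoint_left]
  intro a ha hb
  obtain ⟨i, -, rfl⟩ := Finset.mem_image.mp ha
  obtain ⟨j, -, h⟩ := Finset.mem_image.mp hb
  exact hT.2.2 i j h.symm

-- Strictly increasing last letters force the length of the tuple to be the cardinality of `Y`, so
-- only one summand of the sigma type contributes.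
open Classical in
theorem sum_admissibleTuples_eq_tupleSum (X Y : Finset (Fin v.length)) :
    (∑ T ∈ admissibleTuples v.length,
      if firsts T.2 = X ∧ lasts T.2 = Y then bTuple C v T.2 else 0) =
        tupleSum C v Y.card X Y ∅ := by
  have hcard : Y.card < v.length + 1 :=
    Nat.lt_succ_of_le ((Finset.card_le_univ Y).trans_eq (Fintype.card_fin _))
  rw [admissibleTuples, Finset.sum_filter, Fintype.sum_sigma,
    Fintype.sum_eq_single (⟨Y.card, hcard⟩ : Fin (v.length + 1))]
  · refine Finset.sum_congr rfl fun T _ => ?_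
    rw [← ite_and]
    simp [IsCompatible]
  · intro k hk
    refine Finset.sum_eq_zero fun T _ => ?_
    rw [← ite_and, if_neg]
    rintro ⟨hT, -, rfl⟩
    exact hk (Fin.ext (card_lasts hT).symm)

/-- A sum over admissible tuples, arranged by their sets of first and last letters. -/
theorem sum_admissibleTuples {M : Type*} [AddCommGroup M]
    (g : Finset (Fin v.length) → Finset (Fin v.length) → M) :
    ∑ T ∈ admissibleTuples v.length, bTuple C v T.2 • g (firsts T.2) (lasts T.2) =
      ∑ X : Finset (Fin v.length), ∑ Y ∈ (Finset.univ \ X).powerset,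
        tupleSum C v Y.card X Y ∅ • g X Y := by
  classical
  simp_rw [← sum_admissibleTuples_eq_tupleSum, Finset.sum_smul]
  rw [Finset.sum_congr rfl fun X _ => Finset.sum_comm, Finset.sum_comm]
  refine Finset.sum_congr rfl fun T hT => ?_
  have hmem : lasts T.2 ∈ (Finset.univ \ firsts T.2).powerset := by
    rw [Finset.mem_powerset, Finset.subset_sdiff]
    exact ⟨Finset.subset_univ _,
      (disjoint_firsts_lasts (Finset.mem_filter.mp hT).2).symm⟩
  rw [Fintype.sum_eq_single (firsts T.2), Finset.sum_eq_single_of_mem _ hmem, if_pos ⟨rfl, rfl⟩]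
  · intro Y _ hY
    rw [if_neg fun h => hY h.2.symm, zero_smul]
  · intro X hX
    exact Finset.sum_eq_zero fun Y _ => by rw [if_neg fun h => hX h.1.symm, zero_smul]

end AffineNilHecke

end

open AffineNilHecke TensorProduct in
theorem proposition7p1 {I : Type*} [Finite I] (C : CartanDatum I)
    {P : Type*} [AddCommGroup P] [Module.Free ℤ P] [Module.Finite ℤ P] (D : Realization C P)
    (w : C.Weyl) (v : List I) (hv : C.IsReducedWord w v) :
    NilHecke.phiZeroTwo D (NilHecke.coproduct D (NilHecke.elt D w)) =
      ∑ T ∈ admissibleTuples v.length, bTuple C v T.2 •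
        ∑ u ∈ ((firsts T.2 ∪ lasts T.2)ᶜ).powerset,
          NilCoxeter.word C (subwordAt v (u ∪ lasts T.2)) ⊗ₜ[ℤ]
            NilCoxeter.word C
              (subwordAt v (((firsts T.2 ∪ lasts T.2)ᶜ \ u) ∪ lasts T.2)) := by
  classical
  obtain ⟨hred, rfl⟩ := hv
  have hword := NilHecke.coproduct_wordProduct D (List.finRange v.length)
    (List.pairwise_lt_finRange v.length)
  rw [List.map_get_finRange, NilHecke.word_eq_elt D hred] at hword
  rw [hword, sum_admissibleTuples (fun X Y => ∑ u ∈ ((X ∪ Y)ᶜ).powerset,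
    NilCoxeter.word C (subwordAt v (u ∪ Y)) ⊗ₜ[ℤ]
      NilCoxeter.word C (subwordAt v (((X ∪ Y)ᶜ \ u) ∪ Y)))]
  rw [List.toFinset_finRange, Finset.powerset_univ, NilHecke.phiZeroTwo_sum]
  refine Finset.sum_congr rfl fun X _ => ?_
  rw [NilHecke.phiZeroTwo_sum]
  refine Finset.sum_congr rfl fun Y hY => ?_
  have hXY : Disjoint X Y :=
    (Finset.subset_sdiff.mp (Finset.mem_powerset.mp hY)).2.symm
  have hcompl : (Finset.univ \ X) \ Y = (X ∪ Y)ᶜ := by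
    rw [sdiff_sdiff_left, Finset.compl_eq_univ_sdiff]; rfl
  rw [NilHecke.phiZeroTwo_sum, Finset.smul_sum, hcompl]
  refine Finset.sum_congr rfl fun u _ => ?_
  -- No position is frozen at the start, so `Z = ∅` and the evaluated coefficient is the sum of `b`
  -- over all admissible tuples with first letters `X` and last letters `Y`.
  rw [NilHecke.phiZeroTwo_smul_word, evalZero_positionOps D hXY (Finset.disjoint_empty_right _)
    (Finset.disjoint_empty_right _)]
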